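/- Let $L_0$ be the language with a single relation symbol $E$, which is binary, and let $\mathbf{K}$ be a Fraïssé class of finite $L_0$-structures with the strong amalgamation property (for $A, B_0, B_1 \in \mathbf{K}$ and embeddings $f_t : A \to B_t$ there are $C \in \mathbf{K}$ and embeddings $g_t : B_t \to C$ with $g_0 f_0 = g_1 f_1$ and $g_0(B_0) \cap g_1(B_1) = g_0(f_0(A))$). Let $T$ be the theory of the random graph and $\mathfrak{C}$ an $\aleph_1$-saturated model of $T$. Definitions. For $m \ge 1$ let $\mathbf{K}^{*m}$ be the class of finite structures in the disjoint union of $m$ copies of $L_0$ all of whose $m$ reducts to $L_0$ belong to $\mathbf{K}$ (so $\mathbf{K}^{*1} = \mathbf{K}$ and $\mathbf{K}^{*(m+1)} = \mathbf{K}^{*m} * \mathbf{K}$, where $*$ is free superposition). A $\mathbf{K}^{*m}$-configuration into $\mathfrak{C}^n$ is a map $f : \Gamma \to \mathfrak{C}^n$ from the Fraïssé limit $\Gamma$ of $\mathbf{K}^{*m}$ such that for every relation symbol $R$ of its language there is a formula $\varphi_R$ with parameters from $\mathfrak{C}$ such that $\Gamma \models R(\bar a) \iff \mathfrak{C} \models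 \varphi_R(f(\bar a))$ for all tuples $\bar a$ of $\Gamma$. $\mathrm{Rk}_{\mathbf{K}}(n)$ is the $\mathbf{K}$-rank of $\bar y = \bar y$ for an $n$-tuple of variables $\bar y$: the largest $m \ge 1$ for which there is a $\mathbf{K}^{*m}$-configuration into $\mathfrak{C}^n$, $0$ if there is none, and $\infty$ if there is no largest one. $\mathbf{K}$ is definably self-similar if, for its Fraïssé limit $\Gamma$, every finite $A \subseteq \Gamma$ and every complete non-algebraic $1$-type $p$ over $A$, the induced structure on $p(\Gamma)$ is isomorphic to $\Gamma$. $\mathbf{K}$ is fully relational if for every $k < \omega$ and every assignment of truth values to the $k$-ary relation symbols of $L_0$ there are $A \in \mathbf{K}$ and a $k$-tuple of distinct elements of $A$ at which these symbols take the assigned values. $\mathbf{K}$ is reflexive if $E(a,a)$ always holds in members of $\mathbf{K}$, irreflexive if $E(a,a)$ never holds, symmetric if $E(a,b)$ implies $E(b,a)$, and trichotomous if for all distinct $a, b$ exactly one of $E(a,b)$, $E(b,a)$ holds. Statement. Assume that $\mathbf{K}$ is definably self-similar and fully relational. Then $\mathrm{Rk}_{\mathbf{K}}(n) \le n^2$ for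 all $n \ge 1$. If moreover $\mathbf{K}$ is reflexive or irreflexive, then: 1. if $\mathbf{K}$ is trichotomous, then $\mathrm{Rk}_{\mathbf{K}}(n) < n^2$ for all $n \ge 1$; 2. if $\mathbf{K}$ is symmetric, then $\mathrm{Rk}_{\mathbf{K}}(n) < n^2$ for all $n \ge 2$. -/

import Mathlib

open FirstOrder

universe u v w w'

namespace FirstOrder.Language

/-! ### Theory of the random graph -/

/-- The extension axiom for `k` and `l`: for all `x₁, …, x_k` and `y₁, …, y_l` with `x_i ≠ y_j`
throughout, some `z`, different from all `y_j`, is adjacent to every `x_i` and to no `y_j`. -/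
noncomputable def extensionAxiom (k l : ℕ) : Language.graph.Sentence :=
  Formula.iAlls (α := Empty) (Fin k ⊕ Fin l) <|
    (Formula.iInf fun ij : Fin k × Fin l =>
      ∼((Term.var (Sum.inr (Sum.inl ij.1))).equal (Term.var (Sum.inr (Sum.inr ij.2))))) ⟹
    Formula.iExs (α := Empty ⊕ (Fin k ⊕ Fin l)) Unit
      ((Formula.iInf fun i : Fin k =>
          adj.formula₂ (Term.var (Sum.inr ())) (Term.var (Sum.inl (Sum.inr (Sum.inl i))))) ⊓
        (Formula.iInf fun j : Fin l =>
          ∼(adj.formula₂ (Term.var (Sum.inr ())) (Term.var (Sum.inl (Sum.inr (Sum.inr j))))) ⊓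
          ∼((Term.var (Sum.inr ())).equal (Term.var (Sum.inl (Sum.inr (Sum.inr j)))))))

/-- The theory of the random graph: the axioms of simple graphs and all extension axioms. -/
def randomGraphTheory : Language.graph.Theory :=
  Theory.simpleGraph ∪ Set.range fun kl : ℕ × ℕ => extensionAxiom kl.1 kl.2

theorem realize_extensionAxiom {M : Type w} [Language.graph.Structure M] (k l : ℕ) :
    M ⊨ extensionAxiom k l ↔
      ∀ (x : Fin k → M) (y : Fin l → M), (∀ i j, x i ≠ y j) →
        ∃ z : M, (∀ i, Structure.RelMap adj ![z, x i]) ∧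
          ∀ j, ¬ Structure.RelMap adj ![z, y j] ∧ z ≠ y j := by
  unfold extensionAxiom Sentence.Realize
  rw [Formula.realize_iAlls]
  simp only [Formula.realize_imp, Formula.realize_iInf, Formula.realize_iExs, Formula.realize_inf,
    Formula.realize_not, Formula.realize_rel₂, Formula.realize_equal, Term.realize_var,
    Sum.elim_inr, Sum.elim_inl, Prod.forall]
  constructor
  · intro h x y hxy
    obtain ⟨z, hz⟩ := h (Sum.elim x y) hxy
    exact ⟨z (), hz⟩
  · intro h i hi
    obtain ⟨z, hz⟩ := h (fun a => i (Sum.inl a)) (fun b => i (Sum.inr b)) hi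
    exact ⟨fun _ => z, hz⟩

/-- `ℵ₁`-saturation: every set of formulas in one variable, over a countable set of parameters,
that is finitely satisfiable in `M` is realized in `M`. -/
def IsAlephOneSaturated (L : Language.{u, v}) (M : Type w) [L.Structure M] : Prop :=
  ∀ A : Set M, A.Countable → ∀ p : Set (L[[A]].Formula (Fin 1)),
    (∀ p₀ : Finset (L[[A]].Formula (Fin 1)), (p₀ : Set (L[[A]].Formula (Fin 1))) ⊆ p →
      ∃ b : M, ∀ φ ∈ p₀, φ.Realize fun _ => b) →
    ∃ b : M, ∀ φ ∈ p, φ.Realize fun _ => b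

/-! ### Algebraically trivial Fraïssé classes and free superposition -/

/-- The amalgamation property with amalgams in which the two factors meet only in the base. -/
def StrongAmalgamation {L : Language.{u, v}} (K : Set (CategoryTheory.Bundled.{w} L.Structure)) :
    Prop :=
  ∀ (A B₀ B₁ : CategoryTheory.Bundled.{w} L.Structure) (f₀ : A ↪[L] B₀) (f₁ : A ↪[L] B₁),
    A ∈ K → B₀ ∈ K → B₁ ∈ K →
    ∃ (C : CategoryTheory.Bundled.{w} L.Structure) (g₀ : B₀ ↪[L] C) (g₁ : B₁ ↪[L] C),
      C ∈ K ∧ g₀.comp f₀ = g₁.comp f₁ ∧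
        Set.range g₀ ∩ Set.range g₁ = Set.range (g₀.comp f₀)

/-- A Fraïssé class with strong amalgamation. (In a relational language, Mathlib's requirement
that the members be finitely generated says that they are finite.) -/
structure IsAlgTrivialFraisse {L : Language.{u, v}}
    (K : Set (CategoryTheory.Bundled.{w} L.Structure)) : Prop where
  isFraisse : IsFraisse K
  strongAmalgamation : StrongAmalgamation K

/-- The reduct of a structure in a disjoint union of languages to the left language. -/
def reductLeft {L₀ L₁ : Language.{u, v}} (A : CategoryTheory.Bundled.{w} (L₀.sum L₁).Structure) :
    CategoryTheory.Bundled.{w} L₀.Structure :=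
  ⟨A, (LHom.sumInl : L₀ →ᴸ L₀.sum L₁).reduct A⟩

/-- The reduct of a structure in a disjoint union of languages to the right language. -/
def reductRight {L₀ L₁ : Language.{u, v}} (A : CategoryTheory.Bundled.{w} (L₀.sum L₁).Structure) :
    CategoryTheory.Bundled.{w} L₁.Structure :=
  ⟨A, (LHom.sumInr : L₁ →ᴸ L₀.sum L₁).reduct A⟩

/-- The free superposition `K₀ * K₁`. -/
def freeSuperposition {L₀ L₁ : Language.{u, v}}
    (K₀ : Set (CategoryTheory.Bundled.{w} L₀.Structure))
    (K₁ : Set (CategoryTheory.Bundled.{w} L₁.Structure)) :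
    Set (CategoryTheory.Bundled.{w} (L₀.sum L₁).Structure) :=
  {A | Finite A ∧ reductLeft A ∈ K₀ ∧ reductRight A ∈ K₁}

/-- The language of `K^{*(m+1)}`: the disjoint union of `m + 1` copies of `L`. -/
def powerLanguage (L : Language.{u, v}) : ℕ → Language.{u, v}
  | 0 => L
  | m + 1 => (powerLanguage L m).sum L

instance powerLanguage_isRelational (L : Language.{u, v}) [L.IsRelational] :
    ∀ m, (powerLanguage L m).IsRelational
  | 0 => inferInstanceAs L.IsRelational
  | m + 1 =>
    haveI := powerLanguage_isRelational L m
    inferInstanceAs ((powerLanguage L m).sum L).IsRelational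

/-- `freePower K m` is the free superposition power `K^{*(m+1)}`, given by `K^{*1} = K` and
`K^{*(n+1)} = K^{*n} * K`. -/
def freePower {L : Language.{u, v}} (K : Set (CategoryTheory.Bundled.{w} L.Structure)) :
    (m : ℕ) → Set (CategoryTheory.Bundled.{w} (powerLanguage L m).Structure)
  | 0 => K
  | m + 1 => freeSuperposition (freePower K m) K

/-! ### Properties of classes -/

/-- For all `R` and `a`, if `R(a)` then `R(a ∘ σ)` for every permutation `σ`. -/
def IsSymmetricClass {L : Language.{u, v}} (K : Set (CategoryTheory.Bundled.{w} L.Structure)) :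
    Prop :=
  ∀ A ∈ K, ∀ (n : ℕ) (R : L.Relations n) (a : Fin n → A) (σ : Equiv.Perm (Fin n)),
    Structure.RelMap R a → Structure.RelMap R (a ∘ σ)

/-- For all `R` and `a` with distinct entries, `R(a ∘ σ)` for exactly one permutation `σ`. -/
def IsTrichotomousClass {L : Language.{u, v}} (K : Set (CategoryTheory.Bundled.{w} L.Structure)) :
    Prop :=
  ∀ A ∈ K, ∀ (n : ℕ) (R : L.Relations n) (a : Fin n → A), (∀ i j, i < j → a i ≠ a j) →
    ∃! σ : Equiv.Perm (Fin n), Structure.RelMap R (a ∘ σ)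

/-- `R(a)` for all `R` and all constant tuples `a`. -/
def IsReflexiveClass {L : Language.{u, v}} (K : Set (CategoryTheory.Bundled.{w} L.Structure)) :
    Prop :=
  ∀ A ∈ K, ∀ (n : ℕ) (R : L.Relations n) (a : Fin n → A), (∀ i j, i < j → a i = a j) →
    Structure.RelMap R a

/-- `¬ R(a)` for all `R` and all tuples `a` with a repeated entry. -/
def IsIrreflexiveClass {L : Language.{u, v}} (K : Set (CategoryTheory.Bundled.{w} L.Structure)) :
    Prop :=
  ∀ A ∈ K, ∀ (n : ℕ) (R : L.Relations n) (a : Fin n → A), (∃ i j, i < j ∧ a i = a j) →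
    ¬ Structure.RelMap R a

/-- For every `n`, every assignment of truth values to the `n`-ary relation symbols is attained at
some tuple of `n` distinct elements of a member of `K`. -/
def IsFullyRelational {L : Language.{u, v}} (K : Set (CategoryTheory.Bundled.{w} L.Structure)) :
    Prop :=
  ∀ (n : ℕ) (f : L.Relations n → Bool), ∃ A ∈ K, ∃ a : Fin n → A,
    (∀ i j, i < j → a i ≠ a j) ∧ ∀ R : L.Relations n, Structure.RelMap R a ↔ f R = true

/-- A complete `1`-type over `A` is non-algebraic if each of its formulas has infinitely many
solutions in `M`. -/
def IsNonAlgebraic {L : Language.{u, v}} {M : Type w} [L.Structure M] {A : Set M}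
    (p : (L[[A]].completeTheory M).CompleteType (Fin 1)) : Prop :=
  ∀ φ : L[[A]].Formula (Fin 1), Formula.equivSentence φ ∈ p →
    {b : M | φ.Realize fun _ => b}.Infinite

/-- The set `p(M)` of realizations in `M` of a complete `1`-type `p` over `A ⊆ M`. -/
def typeRealizations {L : Language.{u, v}} {M : Type w} [L.Structure M] {A : Set M}
    (p : (L[[A]].completeTheory M).CompleteType (Fin 1)) : Set M :=
  {b | ∀ φ : L[[A]].Formula (Fin 1), Formula.equivSentence φ ∈ p → φ.Realize fun _ => b}

/-- For every finite `A ⊆ M` and every complete non-algebraic `1`-type `p` over `A`, the set `p(M)`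
is (the universe of) a substructure of `M` isomorphic to `M`. -/
def IsDefinablySelfSimilarStructure (L : Language.{u, v}) (M : Type w) [L.Structure M] : Prop :=
  ∀ A : Set M, A.Finite → ∀ p : (L[[A]].completeTheory M).CompleteType (Fin 1),
    IsNonAlgebraic p → ∃ g : M ↪[L] M, Set.range g = typeRealizations p

/-- The Fraïssé limit of `K` is definably self-similar. (Every Fraïssé class has a Fraïssé limit,
and it is unique up to isomorphism.) -/
def IsDefinablySelfSimilar {L : Language.{u, v}} [L.IsRelational]
    (K : Set (CategoryTheory.Bundled.{w} L.Structure)) : Prop :=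
  ∃ (Γ : Type w) (_ : L.Structure Γ) (_ : Countable Γ),
    IsFraisseLimit K Γ ∧ IsDefinablySelfSimilarStructure L Γ

/-! ### Configurations and ranks -/

/-- The set `π(M)` of realizations in `M` of a set `π` of formulas with parameters from `M`. -/
def realizations {L : Language.{u, v}} {M : Type w} [L.Structure M] {α : Type}
    (π : Set (L[[M]].Formula α)) : Set (α → M) :=
  {b | ∀ φ ∈ π, φ.Realize b}

/-- `f : Γ → π(M)` is a configuration: for every relation symbol `R` of `L₀` some `L(M)`-formula
`φ_R` satisfies `Γ ⊨ R(a) ↔ M ⊨ φ_R(f(a))` for all tuples `a` of `Γ`. -/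
def IsConfiguration {L₀ L : Language} {Γ : Type w} [L₀.Structure Γ] {M : Type w'} [L.Structure M]
    {α : Type} (π : Set (L[[M]].Formula α)) (f : Γ → α → M) : Prop :=
  (∀ c, f c ∈ realizations π) ∧
    ∀ (k : ℕ) (R : L₀.Relations k), ∃ φ : L[[M]].Formula (Fin k × α),
      ∀ a : Fin k → Γ, Structure.RelMap R a ↔ φ.Realize fun ij => f (a ij.1) ij.2

/-- There is a `K`-configuration into `π`, i.e. a configuration defined on the Fraïssé limit of
`K`. (For a Fraïssé class `K`, the limit exists and is unique up to isomorphism.) -/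
def HasConfiguration {L₀ L : Language} [L₀.IsRelational]
    (K : Set (CategoryTheory.Bundled.{w} L₀.Structure)) {M : Type w'} [L.Structure M]
    {α : Type} (π : Set (L[[M]].Formula α)) : Prop :=
  ∃ (Γ : Type w) (_ : L₀.Structure Γ) (_ : Countable Γ) (f : Γ → α → M),
    IsFraisseLimit K Γ ∧ IsConfiguration (L₀ := L₀) π f

/-- The `K`-rank of `π`: the largest `n ≥ 1` for which there is a `K^{*n}`-configuration into `π`,
`0` if there is none, and `∞` if there is no largest one. -/
noncomputable def kRank {L₀ L : Language} [L₀.IsRelational]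
    (K : Set (CategoryTheory.Bundled.{w} L₀.Structure)) {M : Type w'} [L.Structure M]
    {α : Type} (π : Set (L[[M]].Formula α)) : ℕ∞ :=
  ⨆ (m : ℕ) (_ : HasConfiguration (freePower K m) π), ((m + 1 : ℕ) : ℕ∞)

/-- The partial type `ȳ = ȳ` in an `n`-tuple of variables. -/
def eqSelf (L : Language) (M : Type w') (n : ℕ) : Set (L[[M]].Formula (Fin n)) :=
  Set.range fun i => (Term.var i).equal (Term.var i)

/-- `Rk_K(n)`, the `K`-rank of `ȳ = ȳ` for an `n`-tuple of variables `ȳ`, computed in `M`. -/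
noncomputable def kRankTuple {L₀ : Language} (L : Language) [L₀.IsRelational]
    (K : Set (CategoryTheory.Bundled.{w} L₀.Structure)) (M : Type w') [L.Structure M] (n : ℕ) :
    ℕ∞ :=
  kRank K (eqSelf L M n)

/-! ### The index language -/

/-- The relation symbols of the language with a single, binary relation symbol `E`. -/
inductive EdgeRel : ℕ → Type
  | E : EdgeRel 2

/-- The language with a single relation symbol, which is binary. -/
def edgeLanguage : Language :=
  ⟨fun _ => Empty, EdgeRel⟩

instance edgeLanguage_isRelational : edgeLanguage.IsRelational :=
  fun _ => inferInstanceAs (IsEmpty Empty)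

end FirstOrder.Language

namespace FirstOrder.Language

/-! ### Families of binary relations -/

/-! The proof compares relations with adjacency matrices. A configuration of `m + 1` superposed
copies of `K` sends each point of the limit `Γ` to an `n`-tuple of vertices. It is thinned to a copy
of `Γ` inside `Γ` on which the relations between two distinct points depend only on the `n × n`
matrix of adjacencies between their images (`IsGeneric.exists_determined`). Full relationality
realizes all `2 ^ (m + 1)` patterns of relations, and distinct patterns need distinct matrices, so
`m + 1 ≤ n ^ 2` (`le_sq_of_determined`).

If equality holds, patterns and matrices correspond bijectively, and swapping the two points
transposes the matrix. In the trichotomous case some pair has the zero matrix; it equals its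
transpose, so the swap preserves every relation, against trichotomy. In the symmetric case the swap
always preserves the relations, hence the matrix, although for `n ≥ 2` some pair has a non-symmetric
matrix.

The thinning rests on two facts. By the back-and-forth property of the random graph, the truth of a
formula depends only on equalities and adjacencies among its arguments and finitely many parameters.
By self-similarity, the realizations of a one-type over a finite set outside that set contain a copy
of the whole structure. The latter yields `IsGeneric.dichotomy`: a greedy construction of a good
copy either succeeds, or is stuck at a type all of whose realizations are bad, and these contain a
copy. Hence every coordinate map can be made constant or injective, finite colourings constant, and
accidental coincidences absent; only the matrix can still vary.

Self-similarity is recast as closure of the finite members under replacing a point by a member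
(`IsSelfSimilarClass`). This condition concerns one relation at a time, so it passes from `K` to its
free superposition powers. -/

/-- On `T`, the map `e` is injective and preserves and reflects all relations of the family. -/
def IsEmbOn {ι V Γ : Type*} (r : ι → V → V → Prop) (R : ι → Γ → Γ → Prop) (T : Set V)
    (e : V → Γ) : Prop :=
  Set.InjOn e T ∧ ∀ i, ∀ x ∈ T, ∀ y ∈ T, (R i (e x) (e y) ↔ r i x y)

namespace IsEmbOn

variable {ι V W Γ : Type*} {q : ι → W → W → Prop} {r : ι → V → V → Prop} {R : ι → Γ → Γ → Prop}
  {S T : Set V} {e e' : V → Γ}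

theorem mono (h : IsEmbOn r R T e) (hST : S ⊆ T) : IsEmbOn r R S e :=
  ⟨h.1.mono hST, fun i x hx y hy => h.2 i x (hST hx) y (hST hy)⟩

theorem congr (h : IsEmbOn r R T e) (he : Set.EqOn e e' T) : IsEmbOn r R T e' :=
  ⟨h.1.congr he, fun i x hx y hy => by rw [← he hx, ← he hy]; exact h.2 i x hx y hy⟩

theorem injective (h : IsEmbOn r R Set.univ e) : Function.Injective e :=
  Set.injOn_univ.1 h.1

theorem iff (h : IsEmbOn r R Set.univ e) (i : ι) (x y : V) : R i (e x) (e y) ↔ r i x y :=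
  h.2 i x trivial y trivial

theorem comp (h : IsEmbOn r R Set.univ e) {d : W → V} (hd : IsEmbOn q r Set.univ d) :
    IsEmbOn q R Set.univ (e ∘ d) :=
  ⟨Set.injOn_univ.2 (h.injective.comp hd.injective),
    fun i x _ y _ => (h.iff i _ _).trans (hd.iff i x y)⟩

theorem id : IsEmbOn r r Set.univ (id : V → V) :=
  ⟨Set.injOn_id _, fun _ _ _ _ _ => Iff.rfl⟩

/-- The extension step shared by all the inductive constructions. Loops at the new point are a
separate condition, since the relations need not be irreflexive. -/
theorem update [DecidableEq V] (h : IsEmbOn r R T e) {c : V} (hc : c ∉ T) {b : Γ}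
    (hb : ∀ x ∈ T, b ≠ e x) (hbb : ∀ i, R i b b ↔ r i c c)
    (hR : ∀ i, ∀ x ∈ T, (R i b (e x) ↔ r i c x) ∧ (R i (e x) b ↔ r i x c)) :
    IsEmbOn r R (insert c T) (Function.update e c b) := by
  have hne : ∀ x ∈ T, Function.update e c b x = e x := fun x hx =>
    Function.update_of_ne (ne_of_mem_of_not_mem hx hc) _ _
  constructor
  · rintro x (rfl | hx) y (rfl | hy) hxy
    · rfl
    · rw [Function.update_self, hne y hy] at hxy
      exact absurd hxy (hb y hy)
    · rw [Function.update_self, hne x hx] at hxy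
      exact absurd hxy.symm (hb x hx)
    · rw [hne x hx, hne y hy] at hxy
      exact h.1 hx hy hxy
  · rintro i x (rfl | hx) y (rfl | hy)
    · rw [Function.update_self]; exact hbb i
    · rw [Function.update_self, hne y hy]; exact (hR i y hy).1
    · rw [Function.update_self, hne x hx]; exact (hR i x hx).2
    · rw [hne x hx, hne y hy]; exact h.2 i x hx y hy

end IsEmbOn

/-- The relation on `V ⊕ W` which extends `r` on `V` and `s` on `W`, and in which every element of
`W` is related to `V` as the new point of the one-point extension `r` of `V`. -/
def blowUp {V W : Type*} (r : Option V → Option V → Prop) (s : W → W → Prop) :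
    V ⊕ W → V ⊕ W → Prop
  | .inl x, .inl y => r (some x) (some y)
  | .inl x, .inr _ => r (some x) none
  | .inr _, .inl y => r none (some y)
  | .inr x, .inr y => s x y

/-- A class of binary relations on finite types is self-similar if the diagonals of all its members
agree, and if the new point of a one-point extension may be replaced by any member of the class. -/
structure IsSelfSimilarClass (C : ∀ V : Type w, (V → V → Prop) → Prop) : Prop where
  diag : ∀ {V W : Type w} [Finite V] [Finite W] {r : V → V → Prop} {s : W → W → Prop},
    C V r → C W s → ∀ x y, r x x ↔ s y y
  blowUp : ∀ {V W : Type w} [Finite V] [Finite W] {r : Option V → Option V → Prop}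
    {s : W → W → Prop}, C (Option V) r → C W s → C (V ⊕ W) (blowUp r s)

/-- `Γ` with the family `R` is homogeneous and universal for the finite families of relations with
all members in `C`. -/
structure IsGeneric {ι : Type*} {Γ : Type w} (C : ∀ V : Type w, (V → V → Prop) → Prop)
    (R : ι → Γ → Γ → Prop) : Prop where
  age : ∀ {V : Type w} [Finite V] {f : V → Γ}, Function.Injective f → ∀ i,
    C V fun x y => R i (f x) (f y)
  univ : ∀ {V : Type w} [Finite V] {r : ι → V → V → Prop}, (∀ i, C V (r i)) →
    ∃ e : V → Γ, IsEmbOn r R Set.univ e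
  ext : ∀ {V : Type w} [Finite V] {r : ι → V → V → Prop}, (∀ i, C V (r i)) →
    ∀ {T : Set V} {e : V → Γ}, IsEmbOn r R T e →
      ∃ e' : V → Γ, IsEmbOn r R Set.univ e' ∧ Set.EqOn e' e T

/-- A map on a countable type can be built one point at a time. -/
theorem exists_forall_finset {Γ Δ : Type*} [Countable Γ] [DecidableEq Γ]
    {Good : Finset Γ → (Γ → Δ) → Prop}
    (mono : ∀ {S S' g}, Good S g → S' ⊆ S → Good S' g)
    (congr : ∀ {S g g'}, Good S g → (∀ x ∈ S, g x = g' x) → Good S g')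
    (g₀ : Γ → Δ) (zero : Good ∅ g₀)
    (step : ∀ S g, Good S g → ∀ c ∉ S, ∃ b, Good (insert c S) (Function.update g c b)) :
    ∃ g, ∀ S, Good S g := by
  rcases isEmpty_or_nonempty Γ with hΓ | hΓ
  · exact ⟨g₀, fun S => by rwa [Finset.eq_empty_of_isEmpty S]⟩
  obtain ⟨e, he⟩ := exists_surjective_nat Γ
  have next : ∀ (p : {p : Finset Γ × (Γ → Δ) // Good p.1 p.2}) (c : Γ),
      ∃ q : {p : Finset Γ × (Γ → Δ) // Good p.1 p.2},
        p.1.1 ⊆ q.1.1 ∧ (∀ x ∈ p.1.1, q.1.2 x = p.1.2 x) ∧ c ∈ q.1.1 := by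
    rintro ⟨⟨S, g⟩, hp⟩ c
    by_cases hc : c ∈ S
    · exact ⟨⟨⟨S, g⟩, hp⟩, subset_rfl, fun _ _ => rfl, hc⟩
    · obtain ⟨b, hb⟩ := step S g hp c hc
      exact ⟨⟨⟨_, _⟩, hb⟩, Finset.subset_insert _ _,
        fun x hx => Function.update_of_ne (ne_of_mem_of_not_mem hx hc) _ _,
        Finset.mem_insert_self _ _⟩
  choose nxt h₁ h₂ h₃ using next
  let seq : ℕ → {p : Finset Γ × (Γ → Δ) // Good p.1 p.2} :=
    fun n => Nat.rec ⟨⟨∅, g₀⟩, zero⟩ (fun n p => nxt p (e n)) n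
  have hseq : ∀ n m, n ≤ m → (seq n).1.1 ⊆ (seq m).1.1 ∧
      ∀ x ∈ (seq n).1.1, (seq m).1.2 x = (seq n).1.2 x := by
    intro n m hnm
    induction m, hnm using Nat.le_induction with
    | base => exact ⟨subset_rfl, fun _ _ => rfl⟩
    | succ m _ ih =>
      exact ⟨ih.1.trans (h₁ _ _), fun x hx => (h₂ _ _ x (ih.1 hx)).trans (ih.2 x hx)⟩
  choose idx hidx using he
  have hmem : ∀ x, x ∈ (seq (idx x + 1)).1.1 := fun x => by
    have : e (idx x) ∈ (seq (idx x + 1)).1.1 := h₃ (seq (idx x)) (e (idx x))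
    rwa [hidx] at this
  -- By stage `idx x + 1` the point `x` has entered the domain, and its value never changes
  -- afterwards.
  refine ⟨fun x => (seq (idx x + 1)).1.2 x, fun S => ?_⟩
  let N := S.sup fun x => idx x + 1
  have hN : ∀ x ∈ S, idx x + 1 ≤ N := fun x hx => Finset.le_sup (f := fun x => idx x + 1) hx
  exact congr (mono (seq N).2 fun x hx => (hseq _ _ (hN x hx)).1 (hmem x))
    fun x hx => (hseq _ _ (hN x hx)).2 x (hmem x)

/-! ### Copies of a generic structure inside itself -/

section Generic

variable {ι : Type*} {Γ : Type w} {C : ∀ V : Type w, (V → V → Prop) → Prop}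
  {R : ι → Γ → Γ → Prop}

theorem IsGeneric.diag (hR : IsGeneric C R) (hC : IsSelfSimilarClass C) (i : ι) (x y : Γ) :
    R i x x ↔ R i y y :=
  hC.diag (V := PUnit) (W := PUnit) (hR.age (f := fun _ => x) (fun _ _ _ => rfl) i)
    (hR.age (f := fun _ => y) (fun _ _ _ => rfl) i) ⟨⟩ ⟨⟩

/-- Finite partial embeddings of a generic structure into itself extend to one more point. -/
theorem IsGeneric.exists_update [DecidableEq Γ] (hR : IsGeneric C R) {S : Finset Γ} {g : Γ → Γ}
    (hg : IsEmbOn R R S g) {c : Γ} (hc : c ∉ S) :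
    ∃ b, IsEmbOn R R (insert c S : Finset Γ) (Function.update g c b) := by
  obtain ⟨e, he, heq⟩ := hR.ext (V := (insert c S : Finset Γ)) (r := fun i x y => R i x y)
    (fun i => hR.age Subtype.val_injective i) (T := {x | x.1 ∈ S}) (e := fun x => g x)
    ⟨fun x hx y hy h => Subtype.ext (hg.1 hx hy h), fun i x hx y hy => hg.2 i _ hx _ hy⟩
  have hcS : c ∈ insert c S := Finset.mem_insert_self _ _
  have hS : ∀ x ∈ S, x ∈ insert c S := fun x hx => Finset.mem_insert_of_mem hx
  refine ⟨e ⟨c, hcS⟩, ?_⟩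
  rw [Finset.coe_insert]
  refine hg.update (by simpa using hc) (fun x hx h => hc ?_) (fun i => he.iff i _ _)
    fun i x hx => ?_
  · have h₁ : e ⟨c, hcS⟩ = e ⟨x, hS x hx⟩ := h.trans (heq (x := ⟨x, hS x hx⟩) hx).symm
    have h₂ : c = x := congrArg Subtype.val (he.injective h₁)
    exact h₂ ▸ hx
  · rw [← show e ⟨x, hS x hx⟩ = g x from heq (x := ⟨x, hS x hx⟩) hx]
    exact ⟨he.iff i _ _, he.iff i _ _⟩

/-- A generic structure for a self-similar class embeds into the realizations of each one-type over
a finite set. -/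
theorem IsGeneric.exists_embedding_type [Countable Γ] (hR : IsGeneric C R)
    (hC : IsSelfSimilarClass C) (A : Finset Γ) {b : Γ} (hb : b ∉ A) :
    ∃ g : Γ → Γ, IsEmbOn R R Set.univ g ∧ ∀ x, g x ∉ A ∧
      ∀ i, ∀ a ∈ A, (R i (g x) a ↔ R i b a) ∧ (R i a (g x) ↔ R i a b) := by
  classical
  let U : Γ → Prop := fun z => z ∉ A ∧
      ∀ i, ∀ a ∈ A, (R i z a ↔ R i b a) ∧ (R i a z ↔ R i a b)
  refine (exists_forall_finset
    (Good := fun (S : Finset Γ) (g : Γ → Γ) => IsEmbOn R R (S : Set Γ) g ∧ ∀ x ∈ S, U (g x))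
    (fun h hS => ⟨h.1.mono (by exact_mod_cast hS), fun x hx => h.2 x (hS hx)⟩)
    (fun h he => ⟨IsEmbOn.congr h.1 fun x hx => he x (Finset.mem_coe.1 hx),
      fun x hx => he x hx ▸ h.2 x hx⟩) id
    ⟨IsEmbOn.id.mono (Set.subset_univ _), by simp⟩ ?_).elim fun g hg => ?_
  swap
  · refine ⟨g, ⟨Set.injOn_univ.2 fun x y hxy => ?_, fun i x _ y _ => ?_⟩,
      fun x => (hg {x}).2 x (by simp)⟩
    · exact (hg {x, y}).1.1 (by simp) (by simp) hxy
    · exact (hg {x, y}).1.2 i x (by simp) y (by simp)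
  rintro S g ⟨hg, hU⟩ c hc
  let β : Option A → Γ := fun o => o.elim b Subtype.val
  have hβ : Function.Injective β := by
    rintro (_ | x) (_ | y) h
    · rfl
    · exact absurd (show b ∈ A from (show b = y from h) ▸ y.2) hb
    · exact absurd (show b ∈ A from (show (x : Γ) = b from h) ▸ x.2) hb
    · exact congrArg some (Subtype.ext h)
  let γ : ↥(insert c S) → Γ := Subtype.val
  let e₀ : A ⊕ ↥(insert c S) → Γ := Sum.elim Subtype.val fun x => g x
  -- Blow up the point `b` over `A` to the structure on `insert c S`. The inclusion of `A` together
  -- with `g` on `S` is a partial embedding of the result; extending it places `c`.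
  obtain ⟨e, he, heq⟩ := hR.ext (V := A ⊕ (insert c S : Finset Γ))
    (r := fun i => Language.blowUp (fun x y => R i (β x) (β y)) fun x y => R i (γ x) (γ y))
    (fun i => hC.blowUp (hR.age hβ i) (hR.age Subtype.val_injective i))
    (T := {z | ∀ x, z = .inr x → x.1 ∈ S}) (e := e₀) (by
      constructor
      · rintro (x | x) hx (y | y) hy h
        · exact congrArg Sum.inl (Subtype.ext h)
        · exact absurd ((show (x : Γ) = g y from h) ▸ x.2) (hU y (hy y rfl)).1
        · exact absurd ((show g x = (y : Γ) from h) ▸ y.2) (hU x (hx x rfl)).1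
        · exact congrArg Sum.inr (Subtype.ext (hg.1 (hx x rfl) (hy y rfl) h))
      · rintro i (x | x) hx (y | y) hy
        · exact Iff.rfl
        · exact ((hU y (hy y rfl)).2 i x x.2).2
        · exact ((hU x (hx x rfl)).2 i y y.2).1
        · exact hg.2 i x (hx x rfl) y (hy y rfl))
  have hcS : c ∈ insert c S := Finset.mem_insert_self _ _
  have hS : ∀ x ∈ S, x ∈ insert c S := fun x hx => Finset.mem_insert_of_mem hx
  have hA : ∀ a : A, e (.inl a) = a := fun a => heq (x := .inl a) (by simp)
  have hgS : ∀ x (hx : x ∈ S), e (.inr ⟨x, hS x hx⟩) = g x := fun x hx =>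
    heq (x := .inr ⟨x, hS x hx⟩) (by rintro _ ⟨⟩; exact hx)
  set z := e (.inr ⟨c, hcS⟩) with hz
  have hUz : U z := by
    refine ⟨fun h => ?_, fun i a ha => ?_⟩
    · exact Sum.inr_ne_inl (he.injective (hz.symm.trans (hA ⟨z, h⟩).symm))
    · have h₁ := he.iff i (.inr ⟨c, hcS⟩) (.inl ⟨a, ha⟩)
      have h₂ := he.iff i (.inl ⟨a, ha⟩) (.inr ⟨c, hcS⟩)
      rw [hA] at h₁ h₂
      exact ⟨h₁, h₂⟩
  refine ⟨z, ?_, ?_⟩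
  · rw [Finset.coe_insert]
    refine hg.update (by simpa using hc) (fun x hx h => hc ?_) (fun i => he.iff i _ _)
      fun i x hx => ?_
    · rw [← hgS x hx] at h
      have h₂ : c = x := congrArg Subtype.val (Sum.inr_injective (he.injective h))
      exact h₂ ▸ hx
    · rw [← hgS x hx]
      exact ⟨he.iff i _ _, he.iff i _ _⟩
  · intro x hx
    rcases Finset.mem_insert.1 hx with rfl | hx
    · rwa [Function.update_self]
    · rw [Function.update_of_ne (ne_of_mem_of_not_mem hx hc)]
      exact hU x hx

/-- Either a generic structure has a copy of itself with `U` at all points and `D` at all pairs of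
distinct points, or it has one in which every point violates `U`, or `D` with a point of a fixed
finite set. -/
theorem IsGeneric.dichotomy [Countable Γ] (hR : IsGeneric C R) (hC : IsSelfSimilarClass C)
    (U : Γ → Prop) (D : Γ → Γ → Prop) :
    (∃ g : Γ → Γ, IsEmbOn R R Set.univ g ∧ (∀ x, U (g x)) ∧ ∀ x y, x ≠ y → D (g x) (g y)) ∨
    ∃ (A : Finset Γ) (g : Γ → Γ), IsEmbOn R R Set.univ g ∧
      ∀ x, ¬ U (g x) ∨ ∃ a ∈ A, ¬ D a (g x) ∨ ¬ D (g x) a := by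
  classical
  rw [or_iff_not_imp_right]
  intro hno
  refine (exists_forall_finset
    (Good := fun (S : Finset Γ) (g : Γ → Γ) => IsEmbOn R R (S : Set Γ) g ∧ (∀ x ∈ S, U (g x)) ∧
      ∀ x ∈ S, ∀ y ∈ S, x ≠ y → D (g x) (g y))
    (fun h hS => ⟨h.1.mono (by exact_mod_cast hS), fun x hx => h.2.1 x (hS hx),
      fun x hx y hy => h.2.2 x (hS hx) y (hS hy)⟩)
    (fun h he => ⟨IsEmbOn.congr h.1 fun x hx => he x (Finset.mem_coe.1 hx),
      fun x hx => he x hx ▸ h.2.1 x hx,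
      fun x hx y hy => he x hx ▸ he y hy ▸ h.2.2 x hx y hy⟩) id
    ⟨IsEmbOn.id.mono (Set.subset_univ _), by simp, by simp⟩ ?_).elim fun g hg => ?_
  swap
  · refine ⟨g, ⟨Set.injOn_univ.2 fun x y hxy => ?_, fun i x _ y _ => ?_⟩,
      fun x => (hg {x}).2.1 x (by simp), fun x y => (hg {x, y}).2.2 x (by simp) y (by simp)⟩
    · exact (hg {x, y}).1.1 (by simp) (by simp) hxy
    · exact (hg {x, y}).1.2 i x (by simp) y (by simp)
  rintro S g ⟨hg, hU, hD⟩ c hc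
  by_contra hstep
  obtain ⟨b, hb⟩ := hR.exists_update hg hc
  have hne : ∀ x ∈ S, ∀ z, Function.update g c z x = g x := fun x hx z =>
    Function.update_of_ne (ne_of_mem_of_not_mem hx hc) _ _
  have hcS : c ∈ ((insert c S : Finset Γ) : Set Γ) := by simp
  have hS : ∀ x ∈ S, x ∈ ((insert c S : Finset Γ) : Set Γ) := fun x hx => by simp [hx]
  have hbA : b ∉ S.image g := by
    rw [Finset.mem_image]
    rintro ⟨x, hx, rfl⟩
    have := hb.1 hcS (hS x hx) (by rw [Function.update_self, hne x hx])
    exact hc (this ▸ hx)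
  -- Every realization of the type of `b` over the image of `S` is a possible value at `c` as far as
  -- the relations go. As no value works, each point of this copy violates `U`, or `D` with a point
  -- of the image.
  obtain ⟨g', hg', hA⟩ := hR.exists_embedding_type hC (S.image g) hbA
  refine hno ⟨S.image g, g', hg', fun x => ?_⟩
  by_contra hx
  push Not at hx
  refine hstep ⟨g' x, ?_, ?_, ?_⟩
  · rw [Finset.coe_insert]
    refine hg.update (by simpa using hc)
      (fun y hy h => (hA x).1 (h ▸ Finset.mem_image_of_mem g hy)) (fun i => hR.diag hC i _ _)
      fun i y hy => ?_
    have h₁ := hb.2 i c hcS y (hS y hy)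
    have h₂ := hb.2 i y (hS y hy) c hcS
    rw [Function.update_self, hne y hy] at h₁ h₂
    have h := (hA x).2 i (g y) (Finset.mem_image_of_mem g hy)
    exact ⟨h.1.trans h₁, h.2.trans h₂⟩
  · intro y hy
    rcases Finset.mem_insert.1 hy with rfl | hy
    · rw [Function.update_self]; exact hx.1
    · rw [hne y hy]; exact hU y hy
  · intro y hy z hz hyz
    rcases Finset.mem_insert.1 hy with rfl | hy' <;> rcases Finset.mem_insert.1 hz with rfl | hz'
    · exact absurd rfl hyz
    · rw [Function.update_self, hne z hz']; exact (hx.2 _ (Finset.mem_image_of_mem g hz')).2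
    · rw [Function.update_self, hne y hy']; exact (hx.2 _ (Finset.mem_image_of_mem g hy')).1
    · rw [hne y hy', hne z hz']; exact hD y hy' z hz' hyz

/-- For each map with finite range on a generic structure there is a copy of the structure on which
the map is constant. -/
theorem IsGeneric.exists_constant [Countable Γ] (hR : IsGeneric C R) (hC : IsSelfSimilarClass C)
    {X : Type*} (F : Finset X) (h : Γ → X) (hF : ∀ x, h x ∈ F) :
    ∃ g : Γ → Γ, IsEmbOn R R Set.univ g ∧ ∀ x y, h (g x) = h (g y) := by
  classical
  induction F using Finset.induction_on generalizing h with
  | empty => exact ⟨id, IsEmbOn.id, fun x => by simpa using hF x⟩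
  | insert c F _ ih =>
    have key : ∀ g₀ : Γ → Γ, IsEmbOn R R Set.univ g₀ → (∀ x, h (g₀ x) ∈ F) →
        ∃ g : Γ → Γ, IsEmbOn R R Set.univ g ∧ ∀ x y, h (g x) = h (g y) := by
      intro g₀ hg₀ hF₀
      obtain ⟨g₁, hg₁, hc⟩ := ih (h ∘ g₀) hF₀
      exact ⟨g₀ ∘ g₁, hg₀.comp hg₁, hc⟩
    -- With `D` trivial, the second alternative says that the whole copy has the value `c`; the
    -- first one removes `c` from the range.
    rcases hR.dichotomy hC (fun x => h x ≠ c) (fun _ _ => True) with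
      ⟨g, hg, hU, -⟩ | ⟨A, g, hg, hA⟩
    · exact key g hg fun x => (Finset.mem_insert.1 (hF _)).resolve_left (hU x)
    · refine ⟨g, hg, fun x y => ?_⟩
      have : ∀ x, h (g x) = c := fun x => by simpa using hA x
      rw [this, this]

/-- For each map on a generic structure there is a copy of the structure on which the map is
constant or injective. -/
theorem IsGeneric.exists_constant_or_injective [Countable Γ] (hR : IsGeneric C R)
    (hC : IsSelfSimilarClass C) {X : Type*} (h : Γ → X) :
    ∃ g : Γ → Γ, IsEmbOn R R Set.univ g ∧
      ((∀ x y, h (g x) = h (g y)) ∨ Function.Injective (h ∘ g)) := by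
  classical
  rcases hR.dichotomy hC (fun _ => True) (fun x y => h x ≠ h y) with
    ⟨g, hg, -, hD⟩ | ⟨A, g, hg, hA⟩
  · exact ⟨g, hg, .inr fun x y hxy => by_contra fun hne => hD x y hne hxy⟩
  -- Here every value on the copy is already a value on the finite set `A`, so the finite-range case
  -- applies.
  · obtain ⟨g₁, hg₁, hc⟩ := hR.exists_constant hC (A.image h) (h ∘ g) fun x => by
      rcases hA x with hx | ⟨a, ha, hx⟩
      · exact absurd trivial hx
      · have : h a = h (g x) := by
          rcases hx with hx | hx
          · exact not_not.1 hx
          · exact (not_not.1 hx).symm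
        exact Finset.mem_image.2 ⟨a, ha, this⟩
    exact ⟨g ∘ g₁, hg.comp hg₁, .inl hc⟩

/-- The same for finitely many maps at once. -/
theorem IsGeneric.forall_constant_or_injective [Countable Γ] (hR : IsGeneric C R)
    (hC : IsSelfSimilarClass C) {X σ : Type*} [Finite σ] (h : σ → Γ → X) :
    ∃ g : Γ → Γ, IsEmbOn R R Set.univ g ∧
      ∀ s, (∀ x y, h s (g x) = h s (g y)) ∨ Function.Injective (h s ∘ g) := by
  classical
  have := Fintype.ofFinite σ
  suffices H : ∀ F : Finset σ, ∃ g : Γ → Γ, IsEmbOn R R Set.univ g ∧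
      ∀ s ∈ F, (∀ x y, h s (g x) = h s (g y)) ∨ Function.Injective (h s ∘ g) by
    obtain ⟨g, hg, hs⟩ := H Finset.univ
    exact ⟨g, hg, fun s => hs s (Finset.mem_univ s)⟩
  intro F
  induction F using Finset.induction_on with
  | empty => exact ⟨id, IsEmbOn.id, by simp⟩
  | insert t F _ ih =>
    obtain ⟨g, hg, hs⟩ := ih
    obtain ⟨g₁, hg₁, ht⟩ := hR.exists_constant_or_injective hC (h t ∘ g)
    refine ⟨g ∘ g₁, hg.comp hg₁, fun s hs' => ?_⟩
    rcases Finset.mem_insert.1 hs' with rfl | hsF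
    · exact ht
    · exact (hs s hsF).imp (fun H x y => H _ _) fun H => H.comp hg₁.injective

/-- A generic structure has a copy of itself that avoids a finite set and in which a locally finite
relation fails at all pairs of distinct points. -/
theorem IsGeneric.exists_avoiding [Countable Γ] [Infinite Γ] (hR : IsGeneric C R)
    (hC : IsSelfSimilarClass C) {B : Set Γ} (hB : B.Finite) {D : Γ → Γ → Prop}
    (hD₁ : ∀ x, {y | D x y}.Finite) (hD₂ : ∀ x, {y | D y x}.Finite) :
    ∃ g : Γ → Γ, IsEmbOn R R Set.univ g ∧ (∀ x, g x ∉ B) ∧ ∀ x y, x ≠ y → ¬ D (g x) (g y) := by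
  rcases hR.dichotomy hC (fun x => x ∉ B) (fun x y => ¬ D x y) with h | ⟨A, g, hg, hA⟩
  · exact h
  · exfalso
    have hfin : (B ∪ ⋃ a ∈ A, ({y | D a y} ∪ {y | D y a})).Finite :=
      hB.union (A.finite_toSet.biUnion fun a _ => (hD₁ a).union (hD₂ a))
    refine Set.infinite_range_of_injective hg.injective (hfin.subset ?_)
    rintro _ ⟨x, rfl⟩
    simpa using hA x

/-- In a finite `Γ`, the copy of `Γ` realizing the type of `a` over all other points would be
confined to the single point `a`. -/
theorem IsGeneric.infinite [Countable Γ] [Nontrivial Γ] (hR : IsGeneric C R)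
    (hC : IsSelfSimilarClass C) : Infinite Γ := by
  classical
  refine not_finite_iff_infinite.1 fun hfin => ?_
  have := Fintype.ofFinite Γ
  obtain ⟨a, b, hab⟩ := exists_pair_ne Γ
  obtain ⟨g, hg, hA⟩ := hR.exists_embedding_type hC (Finset.univ.erase a)
    (Finset.notMem_erase a _)
  have : ∀ x, g x = a := fun x => by simpa using (hA x).1
  exact hab (hg.injective ((this a).trans (this b).symm))

end Generic

end FirstOrder.Language

namespace FirstOrder.Language

open Structure CategoryTheory

/-! ### Languages of binary relations -/

/-- The family of binary relations of a structure that belongs to a family of binary relation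
symbols. -/
def symRel {L : Language.{u, v}} {ι : Type*} (sym : ι → L.Relations 2) {V : Type*} [L.Structure V]
    (i : ι) (x y : V) : Prop :=
  RelMap (sym i) ![x, y]

/-- The family `sym` exhausts the relation symbols of `L`, and each family of binary relations is
that of some structure. -/
structure IsBinary {L : Language.{u, v}} {ι : Type*} (sym : ι → L.Relations 2) : Prop where
  forall_rel : ∀ {P : ∀ k, L.Relations k → Prop}, (∀ i, P 2 (sym i)) → ∀ k R, P k R
  exists_structure : ∀ {V : Type w} (r : ι → V → V → Prop),
    ∃ _ : L.Structure V, symRel sym (V := V) = r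

theorem isEmbOn_embedding {L : Language.{u, v}} {ι : Type*} (sym : ι → L.Relations 2)
    {V W : Type*} [L.Structure V] [L.Structure W]
    (f : V ↪[L] W) : IsEmbOn (symRel sym) (symRel sym) Set.univ f := by
  refine ⟨f.injective.injOn, fun i x _ y _ => ?_⟩
  unfold symRel
  rw [← f.map_rel]
  refine iff_of_eq (congrArg _ ?_)
  ext j; fin_cases j <;> rfl

section Binary

variable {L : Language.{u, v}} [L.IsRelational] {ι : Type*} {sym : ι → L.Relations 2}

/-- Injective maps which preserve and reflect all relations are embeddings. -/
def IsBinary.embedding (hL : IsBinary.{u, v, w} sym) {V W : Type*} [L.Structure V]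
    [L.Structure W] (f : V → W) (hf : IsEmbOn (symRel sym) (symRel sym) Set.univ f) :
    V ↪[L] W where
  toFun := f
  inj' := hf.injective
  map_fun' g := isEmptyElim g
  map_rel' R a := by
    revert a
    refine hL.forall_rel (P := fun k R => ∀ a : Fin k → V, RelMap R (f ∘ a) ↔ RelMap R a)
      (fun i a => ?_) _ R
    have h := hf.iff i (a 0) (a 1)
    unfold symRel at h
    convert h using 2 <;> ext j <;> fin_cases j <;> rfl

/-- Fraïssé limits of classes given by conditions on the relations are generic. -/
theorem IsBinary.isGeneric (hL : IsBinary.{u, v, w} sym) {K : Set (Bundled.{w} L.Structure)}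
    {C : ∀ V : Type w, (V → V → Prop) → Prop}
    (hK : ∀ (V : Type w) [L.Structure V],
      Bundled.of (c := L.Structure) V ∈ K ↔ Finite V ∧ ∀ i, C V (symRel sym i))
    {Γ : Type w} [L.Structure Γ] [Countable Γ] (hΓ : IsFraisseLimit K Γ) :
    IsGeneric C (symRel sym (V := Γ)) where
  age {V} _ f hf i := by
    obtain ⟨_, hV⟩ := hL.exists_structure fun i x y => symRel sym i (f x) (f y)
    have : Bundled.of (c := L.Structure) V ∈ K := by
      rw [← hΓ.age]
      have hf' : IsEmbOn (symRel sym (V := V)) (symRel sym) Set.univ f := by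
        rw [hV]
        exact ⟨hf.injOn, fun _ _ _ _ _ => Iff.rfl⟩
      exact ⟨fg_iff_finite.2 ‹_›, ⟨hL.embedding f hf'⟩⟩
    have := ((hK V).1 this).2 i
    rwa [hV] at this
  univ {V} _ r hr := by
    obtain ⟨_, hV⟩ := hL.exists_structure r
    have : Bundled.of (c := L.Structure) V ∈ K := (hK V).2 ⟨‹_›, hV ▸ hr⟩
    rw [← hΓ.age] at this
    obtain ⟨-, ⟨e⟩⟩ := this
    have h := isEmbOn_embedding sym e
    exact ⟨e, hV ▸ h⟩
  ext {V} _ r hr T e he := by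
    obtain ⟨_, hV⟩ := hL.exists_structure r
    obtain ⟨_, hT⟩ := hL.exists_structure fun i (x y : T) => r i x y
    have : Bundled.of (c := L.Structure) V ∈ K := (hK V).2 ⟨‹_›, hV ▸ hr⟩
    rw [← hΓ.age] at this
    have : Nonempty (V ↪[L] Γ) := this.2
    have he' : IsEmbOn (symRel sym (V := T)) (symRel sym) Set.univ fun x : T => e x := by
      rw [hT]
      exact ⟨fun x _ y _ h => Subtype.ext (he.1 x.2 y.2 h), fun i x _ y _ => he.2 i x x.2 y y.2⟩
    have hval : IsEmbOn (symRel sym (V := T)) (symRel sym (V := V)) Set.univ Subtype.val := by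
      rw [hT, hV]
      exact ⟨Subtype.val_injective.injOn, fun _ _ _ _ _ => Iff.rfl⟩
    -- With the induced structure on `T`, both `e` and the inclusion into `V` are embeddings, so
    -- homogeneity extends `e` along the inclusion.
    obtain ⟨e', he'⟩ := hΓ.ultrahomogeneous.extend_embedding (fg_iff_finite.2 inferInstance)
      (hL.embedding _ he') (hL.embedding _ hval)
    have h := isEmbOn_embedding sym e'
    exact ⟨e', hV ▸ h, fun x hx => (DFunLike.congr_fun he' (⟨x, hx⟩ : T)).symm⟩

end Binary

/-- The structure given by a binary relation. -/
@[reducible]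
def edgeStructure {V : Type*} (r : V → V → Prop) : edgeLanguage.Structure V where
  funMap f := Empty.elim f
  RelMap | .E => fun a => r (a 0) (a 1)

/-- The relation symbol of `edgeLanguage`. -/
abbrev edgeSym : edgeLanguage.Relations 2 := EdgeRel.E

/-- A class of structures for the language of a binary relation, as a class of binary relations. -/
def EdgeClass (K : Set (Bundled.{w} edgeLanguage.Structure)) (V : Type w) (r : V → V → Prop) :
    Prop :=
  (⟨V, edgeStructure r⟩ : Bundled.{w} edgeLanguage.Structure) ∈ K

theorem isBinary_edgeSym : IsBinary.{0, 0, w} fun _ : Unit => edgeSym where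
  forall_rel h _ R := match R with | .E => h ()
  exists_structure r := ⟨edgeStructure (r ()), rfl⟩

theorem edgeStructure_symRel {V : Type*} [S : edgeLanguage.Structure V] :
    edgeStructure (symRel (fun _ : Unit => edgeSym) (V := V) ()) = S := by
  ext n f a
  · exact Empty.elim f
  · cases f
    have : a = ![a 0, a 1] := by ext j; fin_cases j <;> rfl
    conv_rhs => rw [this]
    rfl

section Fraisse

variable {K : Set (Bundled.{w} edgeLanguage.Structure)}

theorem edgeClass_symRel {V : Type w} [S : edgeLanguage.Structure V] :
    EdgeClass K V (symRel (fun _ : Unit => edgeSym) ()) ↔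
      Bundled.of (c := edgeLanguage.Structure) V ∈ K :=
  iff_of_eq (congrArg (fun S => (⟨V, S⟩ : Bundled.{w} edgeLanguage.Structure) ∈ K)
    edgeStructure_symRel)

variable [hK : IsFraisse K]

theorem EdgeClass.finite {V : Type w} {r : V → V → Prop} (h : EdgeClass K V r) : Finite V := by
  let := edgeStructure r
  have h' : FG edgeLanguage V := hK.FG _ h
  exact h'.finite

theorem EdgeClass.comap {V W : Type w} {r : W → W → Prop} (h : EdgeClass K W r) {f : V → W}
    (hf : Function.Injective f) : EdgeClass K V fun x y => r (f x) (f y) := by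
  have := h.finite
  let := edgeStructure r
  let := edgeStructure fun x y => r (f x) (f y)
  exact hK.hereditary (Bundled.of (c := edgeLanguage.Structure) W) h
    ⟨fg_iff_finite.2 (Finite.of_injective f hf),
    ⟨isBinary_edgeSym.{w}.embedding f ⟨hf.injOn, fun _ _ _ _ _ => Iff.rfl⟩⟩⟩

theorem isGeneric_edge {Γ : Type w} [edgeLanguage.Structure Γ] [Countable Γ]
    (hΓ : IsFraisseLimit K Γ) :
    IsGeneric (EdgeClass K) (symRel (fun _ : Unit => edgeSym) (V := Γ)) := by
  refine isBinary_edgeSym.isGeneric (fun V _ =>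
    ⟨fun h => ⟨FG.finite (L := edgeLanguage) (hK.FG _ h), fun _ => ?_⟩,
    fun h => edgeClass_symRel.1 (h.2 ())⟩) hΓ
  exact edgeClass_symRel.2 h

/-! ### Free superposition powers -/

/-- The `i`-th relation symbol of the union of `m + 1` copies of the language. -/
def powerRel : ∀ m, Fin (m + 1) → (powerLanguage edgeLanguage m).Relations 2
  | 0, _ => edgeSym
  | m + 1, i => Fin.lastCases (motive := fun _ => (powerLanguage edgeLanguage (m + 1)).Relations 2)
      (Sum.inr edgeSym) (fun i => Sum.inl (powerRel m i)) i

theorem powerRel_castSucc (m : ℕ) (i : Fin (m + 1)) :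
    powerRel (m + 1) i.castSucc = Sum.inl (powerRel m i) :=
  Fin.lastCases_castSucc ..

theorem powerRel_last (m : ℕ) : powerRel (m + 1) (Fin.last _) = Sum.inr edgeSym :=
  Fin.lastCases_last ..

/-- The structure given by a family of binary relations. -/
@[reducible]
def powerStructure {V : Type*} : ∀ m, (Fin (m + 1) → V → V → Prop) →
    (powerLanguage edgeLanguage m).Structure V
  | 0, r => edgeStructure (r 0)
  | m + 1, r =>
    letI := powerStructure m fun i => r i.castSucc
    letI := edgeStructure (r (Fin.last _))
    inferInstanceAs (((powerLanguage edgeLanguage m).sum edgeLanguage).Structure V)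

theorem symRel_powerStructure {V : Type*} (m : ℕ) (r : Fin (m + 1) → V → V → Prop) :
    letI := powerStructure m r
    symRel (powerRel m) (V := V) = r := by
  induction m with
  | zero =>
    funext i
    obtain rfl : i = 0 := Fin.fin_one_eq_zero i
    rfl
  | succ m ih =>
    funext i
    induction i using Fin.lastCases with
    | last =>
      funext x y
      unfold symRel
      rw [powerRel_last]
      rfl
    | cast i =>
      have := congrFun (ih fun i => r i.castSucc) i
      funext x y
      rw [← this]
      unfold symRel
      rw [powerRel_castSucc]
      rfl

theorem isBinary_powerRel (m : ℕ) : IsBinary.{0, 0, w} (powerRel m) where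
  forall_rel := by
    induction m with
    | zero =>
      intro P h k R
      cases R with
      | E => exact h 0
    | succ m ih =>
      intro P h k R
      cases R with
      | inl R =>
        refine ih (P := fun k R => P k (Sum.inl R)) (fun i => ?_) k R
        rw [← powerRel_castSucc]
        exact h _
      | inr R =>
        cases R with
        | E =>
          have := h (Fin.last _)
          rwa [powerRel_last] at this
  exists_structure r := ⟨powerStructure m r, symRel_powerStructure m r⟩

/-- This turns superposition into a condition on each relation separately, so that facts about `K`
apply to all its powers. -/
theorem mem_freePower_iff (m : ℕ) : ∀ (V : Type w) [(powerLanguage edgeLanguage m).Structure V],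
    Bundled.of (c := (powerLanguage edgeLanguage m).Structure) V ∈ freePower K m ↔
      Finite V ∧ ∀ i, EdgeClass K V (symRel (powerRel m) i) := by
  induction m with
  | zero =>
    intro V S
    have : EdgeClass K V (symRel (powerRel 0) 0) ↔
        Bundled.of (c := (powerLanguage edgeLanguage 0).Structure) V ∈ freePower K 0 :=
      edgeClass_symRel (S := S)
    constructor
    · intro h
      have h' := this.2 h
      refine ⟨h'.finite, fun i => ?_⟩
      obtain rfl : i = 0 := Fin.fin_one_eq_zero i
      exact h'
    · exact fun h => this.1 (h.2 0)
  | succ m ih =>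
    intro V S
    let : ((powerLanguage edgeLanguage m).sum edgeLanguage).Structure V := S
    let := ((LHom.sumInl : powerLanguage edgeLanguage m →ᴸ
      (powerLanguage edgeLanguage m).sum edgeLanguage).reduct V : Structure _ V)
    let := ((LHom.sumInr : edgeLanguage →ᴸ
      (powerLanguage edgeLanguage m).sum edgeLanguage).reduct V : Structure _ V)
    have hl : ∀ i : Fin (m + 1), EdgeClass K V (symRel (powerRel (m + 1)) i.castSucc) ↔
        EdgeClass K V (symRel (powerRel m) i) := by
      intro i
      unfold symRel
      rw [powerRel_castSucc]
      rfl
    have hr : EdgeClass K V (symRel (powerRel (m + 1)) (Fin.last _)) ↔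
        Bundled.of (c := edgeLanguage.Structure) V ∈ K := by
      rw [← edgeClass_symRel]
      unfold symRel
      rw [powerRel_last]
      rfl
    change Finite V ∧ Bundled.of (c := (powerLanguage edgeLanguage m).Structure) V ∈ freePower K m ∧
      Bundled.of (c := edgeLanguage.Structure) V ∈ K ↔ _
    rw [ih, ← hr]
    simp only [← hl]
    rw [Fin.forall_fin_succ' (P := fun i => EdgeClass K V (symRel (powerRel (m + 1)) i))]
    exact ⟨fun h => ⟨h.1, h.2.1.2, h.2.2⟩, fun h => ⟨h.1, ⟨h.1, h.2.1⟩, h.2.2⟩⟩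

/-- Fraïssé limits of free superposition powers are generic. -/
theorem isGeneric_freePower {m : ℕ} {Γ : Type w} [(powerLanguage edgeLanguage m).Structure Γ]
    [Countable Γ] (hΓ : IsFraisseLimit (freePower K m) Γ) :
    IsGeneric (EdgeClass K) (symRel (powerRel m) (V := Γ)) :=
  (isBinary_powerRel m).isGeneric (fun V _ => mem_freePower_iff m V) hΓ

end Fraisse

/-! ### Definable self-similarity -/

/-- Automorphisms that fix all parameters preserve formulas with parameters. -/
theorem realize_formula_of_fixes {L : Language.{u, v}} {M : Type w} [L.Structure M] {A : Set M}
    (σ : M ≃[L] M) (hσ : ∀ a ∈ A, σ a = a) {α : Type*} (φ : L[[A]].Formula α) (x : α → M) :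
    φ.Realize (fun i => σ (x i)) ↔ φ.Realize x := by
  let τ : M ≃[L[[A]]] M :=
    { σ.toEquiv with
      map_fun' := by
        rintro n (f | c) y
        · exact σ.map_fun f y
        · match n, c with
          | 0, c => exact hσ _ c.2
      map_rel' := by
        rintro n (R | R) y
        · exact σ.map_rel R y
        · exact R.elim }
  exact StrongHomClass.realize_formula τ φ

section SelfSimilar

variable {K : Set (Bundled.{w} edgeLanguage.Structure)} {Γ : Type w} [edgeLanguage.Structure Γ]
  [Countable Γ]

theorem StrongAmalgamation.exists_unbundled {L : Language.{u, v}}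
    {K : Set (Bundled.{w} L.Structure)} (hK : StrongAmalgamation K) {A B₀ B₁ : Type w}
    [L.Structure A] [L.Structure B₀] [L.Structure B₁] (f₀ : A ↪[L] B₀) (f₁ : A ↪[L] B₁)
    (hA : Bundled.of (c := L.Structure) A ∈ K) (hB₀ : Bundled.of (c := L.Structure) B₀ ∈ K)
    (hB₁ : Bundled.of (c := L.Structure) B₁ ∈ K) :
    ∃ (C : Type w) (_ : L.Structure C) (g₀ : B₀ ↪[L] C) (g₁ : B₁ ↪[L] C),
      Bundled.of (c := L.Structure) C ∈ K ∧ (∀ a, g₀ (f₀ a) = g₁ (f₁ a)) ∧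
        ∀ x y, g₀ x = g₁ y → ∃ a, y = f₁ a := by
  obtain ⟨C, g₀, g₁, hC, hcomm, hran⟩ := hK (Bundled.of A) (Bundled.of B₀) (Bundled.of B₁) f₀ f₁
    hA hB₀ hB₁
  refine ⟨C, C.str, g₀, g₁, hC, DFunLike.congr_fun hcomm, fun x y hxy => ?_⟩
  obtain ⟨a, ha⟩ := hran.subset ⟨⟨x, rfl⟩, ⟨y, hxy.symm⟩⟩
  exact ⟨a, g₁.injective (hxy.symm.trans (ha.symm.trans (DFunLike.congr_fun hcomm a)))⟩

/-- A point outside a finite set `A` is moved outside any finite set by some automorphism which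
fixes `A`. -/
theorem exists_automorphism_notMem (hK : IsAlgTrivialFraisse K) (hΓ : IsFraisseLimit K Γ)
    (A F : Finset Γ) {b : Γ} (hb : b ∉ A) :
    ∃ σ : Γ ≃[edgeLanguage] Γ, (∀ a ∈ A, σ a = a) ∧ σ b ∉ F := by
  classical
  have := hK.isFraisse
  have hgen := isGeneric_edge hΓ
  let ind : ∀ S : Finset Γ, edgeLanguage.Structure S := fun S =>
    edgeStructure fun x y => symRel (fun _ : Unit => edgeSym) () (x : Γ) (y : Γ)
  have hind : ∀ S : Finset Γ, Bundled.of (c := edgeLanguage.Structure) S ∈ K := fun S =>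
    hgen.age Subtype.val_injective ()
  let inc : ∀ {S S' : Finset Γ}, S ⊆ S' → S ↪[edgeLanguage] S' := fun {S S'} h =>
    isBinary_edgeSym.{w}.embedding (fun x => ⟨x.1, h x.2⟩)
      ⟨fun x _ y _ hxy => Subtype.ext (congrArg (fun z : S' => z.1) hxy), fun _ _ _ _ _ => Iff.rfl⟩
  have h₀ : A ⊆ A ∪ F := Finset.subset_union_left
  have h₁ : A ⊆ insert b A := Finset.subset_insert _ _
  -- In a strong amalgam of `A ∪ F` and `A ∪ {b}` over `A`, the copy of `b` lies outside that of `A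
  -- ∪ F`. Embedding the amalgam in `Γ` over `A ∪ F` gives the target of `b`, and homogeneity gives
  -- the automorphism.
  obtain ⟨C, _, g₀, g₁, hC, hcomm, hran⟩ :=
    hK.strongAmalgamation.exists_unbundled (inc h₀) (inc h₁) (hind _) (hind _) (hind _)
  have hfin : Finite C := FG.finite (L := edgeLanguage) (hK.isFraisse.FG _ hC)
  have hg₀ := isEmbOn_embedding (fun _ : Unit => edgeSym) g₀
  have hg₁ := isEmbOn_embedding (fun _ : Unit => edgeSym) g₁
  -- The value `b` off the range of `g₀` is a dummy; only the restriction to that range is extended.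
  let e : C → Γ := Function.extend g₀ (fun x => x.1) fun _ => b
  have he : ∀ x, e (g₀ x) = x.1 := fun x => g₀.injective.extend_apply _ _ x
  obtain ⟨e', he', heq⟩ := hgen.ext (fun _ => edgeClass_symRel.2 hC) (T := Set.range g₀)
    (e := e) (by
    constructor
    · rintro _ ⟨x, rfl⟩ _ ⟨y, rfl⟩ hxy
      rw [he, he] at hxy
      exact congrArg g₀ (Subtype.ext hxy)
    · rintro i _ ⟨x, rfl⟩ _ ⟨y, rfl⟩
      rw [he, he]
      exact (hg₀.iff () x y).symm)
  have he₀ : ∀ x, e' (g₀ x) = x.1 := fun x => (heq ⟨x, rfl⟩).trans (he x)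
  have he₁ : ∀ x (hx : x ∈ A), e' (g₁ ⟨x, h₁ hx⟩) = x := fun x hx => by
    have : g₀ ⟨x, h₀ hx⟩ = g₁ ⟨x, h₁ hx⟩ := hcomm ⟨x, hx⟩
    rw [← this, he₀]
  obtain ⟨S, hS⟩ : ∃ S : edgeLanguage.Substructure Γ, (S : Set Γ) = (insert b A : Finset Γ) :=
    ⟨{ carrier := (insert b A : Finset Γ), fun_mem := fun f => isEmptyElim f }, rfl⟩
  have hSb : ∀ x : S, x.1 ∈ insert b A := fun x => by
    have : x.1 ∈ (S : Set Γ) := x.2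
    rwa [hS] at this
  have hSfg : S.FG := Substructure.fg_iff_finite.2 <|
    ((insert b A).finite_toSet.subset hS.subset).to_subtype
  have hemb : IsEmbOn (symRel (fun _ : Unit => edgeSym) (V := S)) (symRel fun _ : Unit => edgeSym)
      Set.univ fun x : S => e' (g₁ ⟨x.1, hSb x⟩) :=
    ⟨fun x _ y _ hxy => Subtype.ext (congrArg (fun z : ↥(insert b A) => z.1)
      (g₁.injective (he'.injective hxy))), fun i x _ y _ => (he'.iff _ _ _).trans <|
        (hg₁.iff () _ _).trans
          ((isEmbOn_embedding (fun _ : Unit => edgeSym) S.subtype).iff () x y)⟩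
  obtain ⟨σ, hσ⟩ := hΓ.ultrahomogeneous S hSfg (isBinary_edgeSym.{w}.embedding _ hemb)
  have hσ' : ∀ x (hx : x ∈ insert b A), σ x = e' (g₁ ⟨x, hx⟩) := fun x hx =>
    (DFunLike.congr_fun hσ (⟨x, hS.symm.subset hx⟩ : S)).symm
  refine ⟨σ, fun a ha => (hσ' a (h₁ ha)).trans (he₁ a ha), fun hF => hb ?_⟩
  have hbA := Finset.mem_insert_self b A
  have h₂ : g₁ ⟨b, hbA⟩ = g₀ ⟨σ b, Finset.mem_union_right _ hF⟩ :=
    he'.injective ((hσ' b hbA).symm.trans (he₀ ⟨σ b, Finset.mem_union_right _ hF⟩).symm)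
  obtain ⟨y, hy⟩ := hran _ _ h₂.symm
  exact (show b = y.1 from congrArg (fun z : ↥(insert b A) => z.1) hy) ▸ y.2

/-- In a definably self-similar structure, the points with the same type as `b` over a finite set
contain the image of an embedding. -/
theorem exists_embedding_realize_iff (hK : IsAlgTrivialFraisse K) (hΓ : IsFraisseLimit K Γ)
    (hs : IsDefinablySelfSimilarStructure edgeLanguage Γ) (A : Finset Γ) {b : Γ} (hb : b ∉ A) :
    ∃ g : Γ ↪[edgeLanguage] Γ, ∀ x, ∀ φ : edgeLanguage[[(A : Set Γ)]].Formula (Fin 1),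
      φ.Realize (fun _ => g x) ↔ φ.Realize fun _ => b := by
  have : Nonempty Γ := ⟨b⟩
  let p := (edgeLanguage[[(A : Set Γ)]].completeTheory Γ).typeOf fun _ : Fin 1 => b
  have hp : ∀ φ : edgeLanguage[[(A : Set Γ)]].Formula (Fin 1),
      Formula.equivSentence φ ∈ p ↔ φ.Realize fun _ => b := fun φ =>
    Theory.CompleteType.formula_mem_typeOf
  -- The type of `b` is non-algebraic: an automorphism fixing `A` moves `b` out of any finite
  -- solution set, yet preserves the formula.
  obtain ⟨g, hg⟩ := hs A A.finite_toSet p fun φ hφ hfin => by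
    obtain ⟨σ, hσ, hσb⟩ := exists_automorphism_notMem hK hΓ A hfin.toFinset hb
    refine hσb ((Set.Finite.mem_toFinset _).2 ?_)
    exact (realize_formula_of_fixes σ (by exact_mod_cast hσ) φ fun _ => b).2 ((hp φ).1 hφ)
  have key : ∀ x, ∀ φ : edgeLanguage[[(A : Set Γ)]].Formula (Fin 1),
      (φ.Realize fun _ => b) → φ.Realize fun _ => g x := fun x φ h => by
    have : g x ∈ typeRealizations p := hg ▸ ⟨x, rfl⟩
    exact this φ ((hp φ).2 h)
  refine ⟨g, fun x φ => ⟨fun h => ?_, key x φ⟩⟩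
  by_contra hn
  exact Formula.realize_not.1 (key x φ.not (Formula.realize_not.2 hn)) h

/-- For the diagonals, a copy of `Γ` inside a one-type over `∅` has the same loops everywhere. For
blow-ups, realize the one-point extension in `Γ`; the realizations of the type of its new point over
the other points contain a copy of `Γ`, hence of `W`. -/
theorem isSelfSimilarClass (hK : IsAlgTrivialFraisse K) (hΓ : IsFraisseLimit K Γ)
    (hs : IsDefinablySelfSimilarStructure edgeLanguage Γ) : IsSelfSimilarClass (EdgeClass K) := by
  classical
  have := hK.isFraisse
  have hgen := isGeneric_edge hΓ
  let E : Γ → Γ → Prop := symRel (fun _ : Unit => edgeSym) ()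
  have key : ∀ (A : Finset Γ) (b : Γ), b ∉ A → ∃ g : Γ → Γ, Function.Injective g ∧
      (∀ x y, E (g x) (g y) ↔ E x y) ∧ ∀ x, (E (g x) (g x) ↔ E b b) ∧ g x ∉ A ∧
        ∀ a ∈ A, (E (g x) a ↔ E b a) ∧ (E a (g x) ↔ E a b) := by
    intro A b hb
    obtain ⟨g, hg⟩ := exists_embedding_realize_iff hK hΓ hs A hb
    have hemb := isEmbOn_embedding (fun _ : Unit => edgeSym) g
    let E' : edgeLanguage[[(A : Set Γ)]].Relations 2 := Sum.inl edgeSym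
    let X : edgeLanguage[[(A : Set Γ)]].Term (Fin 1) := Term.var 0
    let c : ∀ a ∈ A, edgeLanguage[[(A : Set Γ)]].Term (Fin 1) := fun a ha =>
      Constants.term (edgeLanguage.con (⟨a, ha⟩ : (A : Set Γ)))
    have hc : ∀ a (ha : a ∈ A) (z : Fin 1 → Γ), (c a ha).realize z = a := fun a ha z => by
      exact Term.realize_con
    refine ⟨g, hemb.injective, hemb.iff (), fun x => ⟨?_, fun hx => hb ?_, fun a ha => ⟨?_, ?_⟩⟩⟩
    · have h := hg x (E'.formula₂ X X)
      rwa [Formula.realize_rel₂, Formula.realize_rel₂] at h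
    · have h := (hg x (X.equal (c _ hx))).1 (by rw [Formula.realize_equal, hc]; rfl)
      rw [Formula.realize_equal, hc] at h
      exact (show b = g x from h) ▸ hx
    · have h := hg x (E'.formula₂ X (c a ha))
      rwa [Formula.realize_rel₂, Formula.realize_rel₂, hc, hc] at h
    · have h := hg x (E'.formula₂ (c a ha) X)
      rwa [Formula.realize_rel₂, Formula.realize_rel₂, hc, hc] at h
  constructor
  · intro V W _ _ r s hr hs' x y
    obtain ⟨α, hα⟩ := hgen.univ (r := fun _ => r) fun _ => hr
    obtain ⟨β, hβ⟩ := hgen.univ (r := fun _ => s) fun _ => hs'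
    obtain ⟨g, -, hg, h⟩ := key ∅ (α x) (by simp)
    exact (hα.iff () x x).symm.trans <| (h (β y)).1.symm.trans <| (hg _ _).trans (hβ.iff () y y)
  · intro V W _ _ r s hr hs'
    obtain ⟨α, hα⟩ := hgen.univ (r := fun _ => r) fun _ => hr
    obtain ⟨β, hβ⟩ := hgen.univ (r := fun _ => s) fun _ => hs'
    have := Fintype.ofFinite V
    obtain ⟨g, hgi, hg, h⟩ := key (Finset.univ.image fun x => α (some x)) (α none) (by
      simp only [Finset.mem_image, Finset.mem_univ, true_and, not_exists]
      exact fun x hx => Option.some_ne_none _ (hα.injective hx))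
    have hmem : ∀ x, α (some x) ∈ Finset.univ.image fun x => α (some x) := fun x =>
      Finset.mem_image_of_mem _ (Finset.mem_univ x)
    have hf : Function.Injective (Sum.elim (fun x => α (some x)) (g ∘ β)) := by
      refine Function.Injective.sumElim (hα.injective.comp (Option.some_injective _))
        (hgi.comp hβ.injective) fun x y hxy => (h (β y)).2.1 ?_
      exact (show α (some x) = g (β y) from hxy) ▸ hmem x
    have hage : EdgeClass K (V ⊕ W) _ := hgen.age hf ()
    convert hage using 1
    funext z z'
    apply propext
    rcases z with x | x <;> rcases z' with y | y
    · exact (hα.iff () _ _).symm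
    · exact (hα.iff () _ _).symm.trans ((h (β y)).2.2 _ (hmem x)).2.symm
    · exact (hα.iff () _ _).symm.trans ((h (β x)).2.2 _ (hmem y)).1.symm
    · exact (hβ.iff () _ _).symm.trans (hg _ _).symm

end SelfSimilar

end FirstOrder.Language

namespace FirstOrder.Language

open Structure

/-! ### Formulas in the random graph -/

section RandomGraph

variable {M : Type w'} [Language.graph.Structure M]

/-- Adjacency in a structure for the language of graphs. -/
def Adjacent (x y : M) : Prop :=
  RelMap adj ![x, y]

/-- Two tuples have the same equalities and adjacencies among their entries. -/
def SameGraphType {β : Type*} (v v' : β → M) : Prop :=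
  ∀ p q, (v p = v q ↔ v' p = v' q) ∧ (Adjacent (v p) (v q) ↔ Adjacent (v' p) (v' q))

/-- Two tuples have the same equalities and adjacencies among their entries and elements of `C`. -/
def SameGraphTypeOver (C : Finset M) {β : Type*} (v v' : β → M) : Prop :=
  SameGraphType (Sum.elim v (Subtype.val : C → M)) (Sum.elim v' Subtype.val)

theorem SameGraphType.comp {β γ : Type*} {v v' : β → M} (h : SameGraphType v v') (π : γ → β) :
    SameGraphType (v ∘ π) (v' ∘ π) :=
  fun p q => h (π p) (π q)

theorem SameGraphType.symm {β : Type*} {v v' : β → M} (h : SameGraphType v v') :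
    SameGraphType v' v :=
  fun p q => ⟨(h p q).1.symm, (h p q).2.symm⟩

theorem SameGraphTypeOver.mono {C D : Finset M} {β : Type*} {v v' : β → M}
    (h : SameGraphTypeOver D v v') (hCD : C ⊆ D) : SameGraphTypeOver C v v' := by
  have := SameGraphType.comp h (Sum.map id fun c : C => (⟨c.1, hCD c.2⟩ : D))
  unfold SameGraphTypeOver
  convert this using 1 <;> · funext p; cases p <;> rfl

theorem adjacent_irrefl (hM : M ⊨ randomGraphTheory) (x : M) : ¬ Adjacent x x := by
  have : M ⊨ Theory.simpleGraph := hM.mono Set.subset_union_left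
  exact (Theory.simpleGraph_model_iff.1 this).1.irrefl x

theorem adjacent_comm (hM : M ⊨ randomGraphTheory) (x y : M) : Adjacent x y ↔ Adjacent y x := by
  have : M ⊨ Theory.simpleGraph := hM.mono Set.subset_union_left
  have := (Theory.simpleGraph_model_iff.1 this).2.symm
  exact ⟨this x y, this y x⟩

theorem exists_adjacent_iff (hM : M ⊨ randomGraphTheory) {X Y : Set M} (hX : X.Finite)
    (hY : Y.Finite) (hXY : Disjoint X Y) :
    ∃ z, (∀ x ∈ X, Adjacent z x) ∧ ∀ y ∈ Y, ¬ Adjacent z y ∧ z ≠ y := by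
  obtain ⟨k, x, -, hx⟩ := hX.fin_param
  obtain ⟨l, y, -, hy⟩ := hY.fin_param
  have := (realize_extensionAxiom (M := M) k l).1
    (hM.realize_of_mem _ (Or.inr ⟨(k, l), rfl⟩)) x y fun i j =>
      hXY.ne_of_mem (hx ▸ ⟨i, rfl⟩) (hy ▸ ⟨j, rfl⟩)
  obtain ⟨z, hzx, hzy⟩ := this
  refine ⟨z, ?_, ?_⟩
  · rw [← hx]
    rintro _ ⟨i, rfl⟩
    exact hzx i
  · rw [← hy]
    rintro _ ⟨j, rfl⟩
    exact hzy j

/-- The back-and-forth step: a new point is matched by the extension axioms applied to the images of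
its neighbours and non-neighbours, which are disjoint because both tuples have the same equalities.
-/
theorem SameGraphType.exists_extend (hM : M ⊨ randomGraphTheory) {β : Type*} [Finite β]
    {v v' : β → M} (h : SameGraphType v v') (z : M) :
    ∃ z', SameGraphType (fun o : Option β => o.elim z v) fun o => o.elim z' v' := by
  suffices H : ∃ z', ∀ p, (z = v p ↔ z' = v' p) ∧ (Adjacent z (v p) ↔ Adjacent z' (v' p)) by
    obtain ⟨z', hz'⟩ := H
    refine ⟨z', ?_⟩
    rintro (_ | p) (_ | q)
    · exact ⟨by simp, iff_of_false (adjacent_irrefl hM z) (adjacent_irrefl hM z')⟩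
    · exact hz' q
    · refine ⟨eq_comm.trans ((hz' p).1.trans eq_comm), ?_⟩
      exact (adjacent_comm hM _ _).trans ((hz' p).2.trans (adjacent_comm hM _ _))
    · exact h p q
  by_cases hz : ∃ p, z = v p
  · obtain ⟨p, rfl⟩ := hz
    exact ⟨v' p, fun q => h p q⟩
  · push Not at hz
    obtain ⟨z', h₁, h₂⟩ := exists_adjacent_iff hM (X := v' '' {p | Adjacent z (v p)})
      (Y := v' '' {p | ¬ Adjacent z (v p)}) (Set.toFinite _) (Set.toFinite _) (by
        rw [Set.disjoint_left]
        rintro _ ⟨p, hp, rfl⟩ ⟨q, hq, hqp⟩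
        have : v p = v q := (h p q).1.2 hqp.symm
        exact hq (this ▸ hp))
    refine ⟨z', fun p => ?_⟩
    by_cases hp : Adjacent z (v p)
    · have := h₁ _ ⟨p, hp, rfl⟩
      refine ⟨iff_of_false (hz p) ?_, iff_of_true hp this⟩
      rintro rfl
      exact adjacent_irrefl hM _ this
    · have := h₂ _ ⟨p, hp, rfl⟩
      exact ⟨iff_of_false (hz p) this.2, iff_of_false hp this.1⟩

theorem exists_realize_term_eq {β : Type*} (t : Language.graph[[M]].Term β) :
    ∃ (C : Finset M) (p : β ⊕ C), ∀ v : β → M, t.realize v = Sum.elim v Subtype.val p := by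
  cases t with
  | var p => exact ⟨∅, .inl p, fun _ => rfl⟩
  | @func l f ts =>
    rcases f with f | c
    · exact isEmptyElim f
    · match l, c with
      | 0, c =>
        let a : M := c
        exact ⟨{a}, .inr ⟨a, Finset.mem_singleton_self a⟩, fun _ => rfl⟩

/-- The truth value of a formula in the random graph depends only on the equalities and adjacencies
among its arguments and a finite set of parameters. -/
theorem exists_realize_iff_of_sameGraphTypeOver (hM : M ⊨ randomGraphTheory) {α : Type*} [Finite α]
    {k : ℕ} (φ : Language.graph[[M]].BoundedFormula α k) :
    ∃ C : Finset M, ∀ (v v' : α → M) (xs xs' : Fin k → M),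
      SameGraphTypeOver C (Sum.elim v xs) (Sum.elim v' xs') →
        (φ.Realize v xs ↔ φ.Realize v' xs') := by
  classical
  have terms : ∀ {k : ℕ} (t s : Language.graph[[M]].Term (α ⊕ Fin k)), ∃ C : Finset M,
      ∀ (v v' : α ⊕ Fin k → M), SameGraphTypeOver C v v' →
        (t.realize v = s.realize v ↔ t.realize v' = s.realize v') ∧
        (Adjacent (t.realize v) (s.realize v) ↔ Adjacent (t.realize v') (s.realize v')) := by
    intro k t s
    obtain ⟨C, p, hp⟩ := exists_realize_term_eq t
    obtain ⟨D, q, hq⟩ := exists_realize_term_eq s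
    refine ⟨C ∪ D, fun v v' h => ?_⟩
    have hC : C ⊆ C ∪ D := Finset.subset_union_left
    have hD : D ⊆ C ∪ D := Finset.subset_union_right
    have := h (Sum.map id (fun c => ⟨c.1, hC c.2⟩) p) (Sum.map id (fun c => ⟨c.1, hD c.2⟩) q)
    rw [hp, hp, hq, hq]
    rcases p with p | p <;> rcases q with q | q <;> exact this
  induction φ with
  | falsum => exact ⟨∅, fun _ _ _ _ _ => Iff.rfl⟩
  | equal t s =>
    obtain ⟨C, hC⟩ := terms t s
    exact ⟨C, fun v v' xs xs' h => (hC _ _ h).1⟩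
  | rel R ts =>
    rcases R with R | R
    · cases R with
      | adj =>
        obtain ⟨C, hC⟩ := terms (ts 0) (ts 1)
        refine ⟨C, fun v v' xs xs' h => ?_⟩
        have key : ∀ y : Fin 2 → M, y = ![y 0, y 1] := fun y => by ext j; fin_cases j <;> rfl
        have h' := (hC _ _ h).2
        unfold Adjacent at h'
        rw [← key fun i => (ts i).realize (Sum.elim v xs),
          ← key fun i => (ts i).realize (Sum.elim v' xs')] at h'
        exact h'
    · exact isEmptyElim R
  | imp φ ψ ihφ ihψ =>
    obtain ⟨C, hC⟩ := ihφ
    obtain ⟨D, hD⟩ := ihψ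
    refine ⟨C ∪ D, fun v v' xs xs' h => ?_⟩
    rw [BoundedFormula.realize_imp, BoundedFormula.realize_imp,
      hC _ _ _ _ (h.mono Finset.subset_union_left), hD _ _ _ _ (h.mono Finset.subset_union_right)]
  | @all k φ ih =>
    obtain ⟨C, hC⟩ := ih
    -- A quantifier needs no further parameters, since any witness for one tuple is matched by a
    -- witness for the other.
    have key : ∀ (v v' : α → M) (xs xs' : Fin k → M),
        SameGraphTypeOver C (Sum.elim v xs) (Sum.elim v' xs') → ∀ z, ∃ z',
          SameGraphTypeOver C (Sum.elim v (Fin.snoc xs z : Fin (k + 1) → M))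
            (Sum.elim v' (Fin.snoc xs' z' : Fin (k + 1) → M)) := by
      intro v v' xs xs' h z
      obtain ⟨z', hz'⟩ := SameGraphType.exists_extend hM h z
      refine ⟨z', ?_⟩
      let π : (α ⊕ Fin (k + 1)) ⊕ C → Option ((α ⊕ Fin k) ⊕ C) :=
        Sum.elim (Sum.elim (fun a => some (.inl (.inl a)))
          (Fin.snoc (α := fun _ => Option ((α ⊕ Fin k) ⊕ C))
            (fun i => some (.inl (.inr i))) none)) fun c => some (.inr c)
      have hπ : ∀ (v : α → M) (xs : Fin k → M) (z : M),
          Sum.elim (Sum.elim v (Fin.snoc xs z : Fin (k + 1) → M)) Subtype.val =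
            (fun o => o.elim z (Sum.elim (Sum.elim v xs) (Subtype.val : C → M))) ∘ π := by
        intro v xs z
        funext p
        rcases p with (a | i) | c
        · rfl
        · induction i using Fin.lastCases <;> simp [π]
        · rfl
      unfold SameGraphTypeOver
      rw [hπ, hπ]
      exact hz'.comp π
    refine ⟨C, fun v v' xs xs' h => ?_⟩
    rw [BoundedFormula.realize_all, BoundedFormula.realize_all]
    constructor
    · intro H z'
      obtain ⟨z, hz⟩ := key v' v xs' xs h.symm z'
      exact (hC _ _ _ _ hz).2 (H z)
    · intro H z
      obtain ⟨z', hz'⟩ := key v v' xs xs' h z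
      exact (hC _ _ _ _ hz').2 (H z')

theorem exists_realize_formula_iff (hM : M ⊨ randomGraphTheory) {α : Type*} [Finite α]
    (φ : Language.graph[[M]].Formula α) :
    ∃ C : Finset M, ∀ v v' : α → M, SameGraphTypeOver C v v' → (φ.Realize v ↔ φ.Realize v') := by
  obtain ⟨C, hC⟩ := exists_realize_iff_of_sameGraphTypeOver hM φ
  refine ⟨C, fun v v' h => hC v v' default default ?_⟩
  have := SameGraphType.comp h
    (Sum.elim (Sum.elim .inl fun i : Fin 0 => i.elim0) .inr : (α ⊕ Fin 0) ⊕ C → α ⊕ C)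
  unfold SameGraphTypeOver
  convert this using 1 <;>
  · funext p
    rcases p with (a | i) | c
    · rfl
    · exact i.elim0
    · rfl

end RandomGraph

end FirstOrder.Language

namespace FirstOrder.Language

open Structure CategoryTheory

/-! ### Configurations into the random graph -/

section Configurations

variable {M : Type w'} [Language.graph.Structure M] {ι : Type*} {Γ : Type w}
  {C : ∀ V : Type w, (V → V → Prop) → Prop} {R : ι → Γ → Γ → Prop}

/-- For each map from a generic structure to tuples in the random graph there is a copy of the
structure on which the type over `A` of the image of a pair of distinct points depends only on the
adjacencies between the two tuples. -/
theorem IsGeneric.exists_sameGraphTypeOver [Countable Γ] [Infinite Γ] (hM : M ⊨ randomGraphTheory)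
    (hR : IsGeneric C R) (hC : IsSelfSimilarClass C) {n : ℕ} (f : Γ → Fin n → M) (A : Finset M) :
    ∃ g : Γ → Γ, IsEmbOn R R Set.univ g ∧ ∀ a b a' b', a ≠ b → a' ≠ b' →
      (∀ s t, Adjacent (f (g a) s) (f (g b) t) ↔ Adjacent (f (g a') s) (f (g b') t)) →
      SameGraphTypeOver A (fun ij : Fin 2 × Fin n => f (g (![a, b] ij.1)) ij.2)
        fun ij => f (g (![a', b'] ij.1)) ij.2 := by
  classical
  obtain ⟨g₁, hg₁, hci⟩ := hR.forall_constant_or_injective hC fun s x => f x s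
  let Const : Fin n → Prop := fun s => ∀ x y, f (g₁ x) s = f (g₁ y) s
  let Inj : Fin n → Prop := fun s => ∀ x y, f (g₁ x) s = f (g₁ y) s → x = y
  replace hci : ∀ s, Const s ∨ Inj s := fun s => (hci s).imp id fun h x y hxy => h hxy
  -- A constant and an injective coordinate agree at no more than one point, and an injective
  -- coordinate takes a given value at most once. Hence the coincidences to be avoided are finite,
  -- respectively locally finite.
  obtain ⟨g₂, hg₂, hB, hD⟩ := hR.exists_avoiding hC
    (B := ⋃ s, ⋃ t, {x | Const s ∧ Inj t ∧ f (g₁ x) s = f (g₁ x) t})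
    (Set.finite_iUnion fun s => Set.finite_iUnion fun t => Set.Subsingleton.finite
      fun x hx y hy => hx.2.1 x y (hx.2.2.symm.trans ((hx.1 x y).trans hy.2.2)))
    (D := fun x y => ∃ s t, Inj s ∧ Inj t ∧ f (g₁ x) s = f (g₁ y) t)
    (fun x => by
      simp only [Set.ofPred_exists]
      exact Set.finite_iUnion fun s => Set.finite_iUnion fun t => Set.Subsingleton.finite
        fun y hy y' hy' => hy.2.1 y y' (hy.2.2.symm.trans hy'.2.2))
    (fun x => by
      simp only [Set.ofPred_exists]
      exact Set.finite_iUnion fun s => Set.finite_iUnion fun t => Set.Subsingleton.finite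
        fun y hy y' hy' => hy.1 y y' (hy.2.2.trans hy'.2.2.symm))
  replace hB : ∀ x s t, Const s → Inj t → f (g₁ (g₂ x)) s ≠ f (g₁ (g₂ x)) t :=
    fun x s t hs ht h => hB x (Set.mem_iUnion₂.2 ⟨s, t, hs, ht, h⟩)
  let tuple : Γ → Fin n ⊕ A → M := fun x => Sum.elim (f (g₁ (g₂ x))) Subtype.val
  -- The graph type over `A` of a single image tuple is one of finitely many colours, and is made
  -- constant.
  have := Fintype.ofFinite (Fin n ⊕ A → Fin n ⊕ A → Prop × Prop)
  obtain ⟨g₃, hg₃, hcol⟩ := hR.exists_constant hC Finset.univ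
    (fun x (p q : Fin n ⊕ A) => (tuple x p = tuple x q, Adjacent (tuple x p) (tuple x q)))
    fun _ => Finset.mem_univ _
  replace hcol : ∀ x y, SameGraphTypeOver A (f (g₁ (g₂ (g₃ x)))) (f (g₁ (g₂ (g₃ y)))) :=
    fun x y p q => by
      have := Prod.ext_iff.1 (congrFun (congrFun (hcol x y) p) q)
      exact ⟨iff_of_eq this.1, iff_of_eq this.2⟩
  let F : Γ → Fin n → M := fun x => f (g₁ (g₂ (g₃ x)))
  -- Coordinates at distinct points can now agree only if both are constant, so the equality pattern
  -- is the same for all pairs.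
  have heq : ∀ a b, a ≠ b → ∀ s t, F a s = F b t ↔ ∀ x y, F x s = F y t := by
    intro a b hab s t
    refine ⟨fun h => ?_, fun h => h a b⟩
    rcases hci s with hs | hs <;> rcases hci t with ht | ht
    · exact fun x y => (hs _ _).trans (h.trans (ht _ _))
    · exact absurd ((hs _ _).trans h) (hB (g₃ b) s t hs ht)
    · exact absurd ((ht _ _).trans h.symm) (hB (g₃ a) t s ht hs)
    · exact absurd ⟨s, t, hs, ht, h⟩ (hD _ _ (hg₃.injective.ne hab))
  refine ⟨g₁ ∘ g₂ ∘ g₃, hg₁.comp (hg₂.comp hg₃), fun a b a' b' hab hab' hX => ?_⟩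
  have h01 : ∀ s t, (F a s = F b t ↔ F a' s = F b' t) ∧
      (Adjacent (F a s) (F b t) ↔ Adjacent (F a' s) (F b' t)) := fun s t =>
    ⟨(heq a b hab s t).trans (heq a' b' hab' s t).symm, hX s t⟩
  rintro (⟨i, s⟩ | c) (⟨j, t⟩ | d)
  · fin_cases i <;> fin_cases j
    · exact hcol a a' (.inl s) (.inl t)
    · exact h01 s t
    · have h := h01 t s
      rw [adjacent_comm hM, adjacent_comm hM (F a' t), eq_comm, eq_comm (a := F a' t)] at h
      exact h
    · exact hcol b b' (.inl s) (.inl t)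
  · fin_cases i
    · exact hcol a a' (.inl s) (.inr d)
    · exact hcol b b' (.inl s) (.inr d)
  · fin_cases j
    · exact hcol a a' (.inr c) (.inl t)
    · exact hcol b b' (.inr c) (.inl t)
  · exact hcol a a' (.inr c) (.inr d)

/-- A configuration on a generic structure restricts to one in which the relations between two
distinct points are determined by the adjacencies between their images. -/
theorem IsGeneric.exists_determined [Finite ι] [Countable Γ] [Infinite Γ]
    (hM : M ⊨ randomGraphTheory) (hR : IsGeneric C R) (hC : IsSelfSimilarClass C) {n : ℕ}
    {f : Γ → Fin n → M} (hf : ∀ i, ∃ φ : Language.graph[[M]].Formula (Fin 2 × Fin n),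
      ∀ a b, R i a b ↔ φ.Realize fun ij => f (![a, b] ij.1) ij.2) :
    ∃ f' : Γ → Fin n → M, ∀ a b a' b', a ≠ b → a' ≠ b' →
      (∀ s t, Adjacent (f' a s) (f' b t) ↔ Adjacent (f' a' s) (f' b' t)) →
      ∀ i, R i a b ↔ R i a' b' := by
  classical
  have := Fintype.ofFinite ι
  choose φ hφ using hf
  choose A hA using fun i => exists_realize_formula_iff hM (φ i)
  obtain ⟨g, hg, h⟩ := hR.exists_sameGraphTypeOver hM hC f (Finset.univ.biUnion A)
  refine ⟨f ∘ g, fun a b a' b' hab hab' hX i => ?_⟩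
  -- As `g` is an embedding, the relations can be read off at the images under `g`, where the
  -- defining formulas see the thinned tuples.
  rw [← hg.iff, ← hg.iff i a', hφ, hφ]
  have key : ∀ a b, (fun ij : Fin 2 × Fin n => f (![g a, g b] ij.1) ij.2) =
      fun ij => f (g (![a, b] ij.1)) ij.2 := by
    intro a b
    funext ⟨j, s⟩
    fin_cases j <;> rfl
  rw [key, key]
  exact hA i _ _ ((h a b a' b' hab hab' hX).mono
    (Finset.subset_biUnion_of_mem A (Finset.mem_univ i)))

/-- The relations are independent: a two-point relation is chosen for each index, and universality
realizes all of them on one pair. -/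
theorem IsGeneric.exists_pair (hR : IsGeneric C R)
    (hC : ∀ p : Prop, ∃ r : ULift.{w} Bool → ULift.{w} Bool → Prop,
      C _ r ∧ (r ⟨false⟩ ⟨true⟩ ↔ p)) (ε : ι → Prop) :
    ∃ a b, a ≠ b ∧ ∀ i, R i a b ↔ ε i := by
  choose r hr hr' using fun i => hC (ε i)
  obtain ⟨e, he⟩ := hR.univ hr
  exact ⟨e ⟨false⟩, e ⟨true⟩, he.injective.ne (by simp), fun i => (he.iff i _ _).trans (hr' i)⟩

end Configurations

/-! ### Counting patterns against matrices -/

section Counting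

variable {m n : ℕ} {Γ : Type*} {R : Fin m → Γ → Γ → Prop} {X : Γ → Γ → Fin n → Fin n → Prop}

/-- If an `n × n` matrix of truth values determines `m` relations that can take arbitrary values,
then `m ≤ n ^ 2`; if `m = n ^ 2`, then all matrices occur, and they are determined by the
relations. -/
theorem le_sq_of_determined (hR : ∀ ε : Fin m → Prop, ∃ a b, a ≠ b ∧ ∀ i, R i a b ↔ ε i)
    (hX : ∀ a b a' b', a ≠ b → a' ≠ b' → X a b = X a' b' → ∀ i, R i a b ↔ R i a' b') :
    m ≤ n ^ 2 ∧ (m = n ^ 2 → (∀ Y, ∃ a b, a ≠ b ∧ X a b = Y) ∧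
      ∀ a b a' b', a ≠ b → a' ≠ b' → (∀ i, R i a b ↔ R i a' b') → X a b = X a' b') := by
  classical
  choose a b hab hε using hR
  have hinj : Function.Injective fun ε => X (a ε) (b ε) := fun ε ε' h => by
    funext i
    exact propext <| (hε ε i).symm.trans <|
      (hX _ _ _ _ (hab ε) (hab ε') h i).trans (hε ε' i)
  have hcard : Fintype.card (Fin n → Fin n → Prop) = 2 ^ (n ^ 2) := by
    simp [← pow_mul, sq]
  have hcard' : Fintype.card (Fin m → Prop) = 2 ^ m := by simp
  refine ⟨?_, fun hm => ?_⟩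
  · have := Fintype.card_le_of_injective _ hinj
    rw [hcard, hcard'] at this
    exact (Nat.pow_le_pow_iff_right (by norm_num)).1 this
  · have hsurj : ∀ Y, ∃ ε, X (a ε) (b ε) = Y :=
      ((Fintype.bijective_iff_injective_and_card _).2
        ⟨hinj, by rw [hcard, hcard', hm]⟩).surjective
    refine ⟨fun Y => ?_, fun c d c' d' hcd hcd' h => ?_⟩
    · obtain ⟨ε, h⟩ := hsurj Y
      exact ⟨a ε, b ε, hab ε, h⟩
    -- Each matrix is that of a chosen representative, whose pattern must be the pattern of the
    -- given pair; equal patterns give the same representative.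
    · obtain ⟨ε, hY⟩ := hsurj (X c d)
      obtain ⟨ε', hY'⟩ := hsurj (X c' d')
      have : ε = ε' := by
        funext i
        exact propext <| (hε ε i).symm.trans <| (hX _ _ _ _ (hab ε) hcd hY i).trans <|
          (h i).trans <| (hX _ _ _ _ (hab ε') hcd' hY' i).symm.trans (hε ε' i)
      rw [← hY, ← hY', this]

end Counting

/-! ### From configurations to matrices and rank bounds -/

section Rank

variable {K : Set (Bundled.{w} edgeLanguage.Structure)}

theorem EdgeClass.trichotomous (hK : IsTrichotomousClass K) {V : Type w} {r : V → V → Prop}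
    (h : EdgeClass K V r) {x y : V} (hxy : x ≠ y) : r x y ↔ ¬ r y x := by
  have hσ : ∀ σ : Equiv.Perm (Fin 2), σ = 1 ∨ σ = Equiv.swap 0 1 := by decide
  obtain ⟨σ, hr, huniq⟩ := hK _ h 2 edgeSym ![x, y] (by
    intro i j hij
    fin_cases i <;> fin_cases j <;> first | exact hxy | exact absurd hij (by decide))
  have h₁ : r x y → 1 = σ := huniq 1
  have h₂ : r y x → Equiv.swap 0 1 = σ := huniq (Equiv.swap 0 1)
  constructor
  · intro hx hy
    exact absurd ((h₁ hx).trans (h₂ hy).symm) (by decide)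
  · intro hy
    rcases hσ σ with rfl | rfl
    · exact hr
    · exact absurd hr hy

theorem EdgeClass.symmetric (hK : IsSymmetricClass K) {V : Type w} {r : V → V → Prop}
    (h : EdgeClass K V r) {x y : V} (hxy : r x y) : r y x :=
  hK _ h 2 edgeSym ![x, y] (Equiv.swap 0 1) hxy

theorem IsFullyRelational.exists_edge [IsFraisse K] (hK : IsFullyRelational K) (p : Prop) :
    ∃ r : ULift.{w} Bool → ULift.{w} Bool → Prop, EdgeClass K _ r ∧ (r ⟨false⟩ ⟨true⟩ ↔ p) := by
  classical
  obtain ⟨A, hA, a, ha, hR⟩ := hK 2 fun _ => decide p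
  have hA' : EdgeClass K A (symRel (fun _ : Unit => edgeSym) ()) := edgeClass_symRel.2 hA
  have hne := ha 0 1 (by decide)
  refine ⟨_, hA'.comap (f := fun b : ULift Bool => bif b.down then a 1 else a 0) ?_, ?_⟩
  · rintro ⟨_ | _⟩ ⟨_ | _⟩ h
    · rfl
    · exact absurd h hne
    · exact absurd h.symm hne
    · rfl
  · have h := hR edgeSym
    have : a = ![a 0, a 1] := by ext j; fin_cases j <;> rfl
    rw [this, decide_eq_true_iff] at h
    exact h

/-- A configuration of `m + 1` relations into `n`-tuples of the random graph yields an `n × n`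
matrix of truth values for every pair of distinct points that determines the relations. -/
theorem HasConfiguration.exists_matrix {M : Type w'} [Language.graph.Structure M]
    (hM : M ⊨ randomGraphTheory) (hK : IsAlgTrivialFraisse K) (hss : IsDefinablySelfSimilar K)
    (hfr : IsFullyRelational K) {m n : ℕ}
    (h : HasConfiguration (freePower K m) (eqSelf Language.graph M n)) :
    ∃ (Γ : Type w) (R : Fin (m + 1) → Γ → Γ → Prop) (X : Γ → Γ → Fin n → Fin n → Prop),
      (∀ ε : Fin (m + 1) → Prop, ∃ a b, a ≠ b ∧ ∀ i, R i a b ↔ ε i) ∧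
      (∀ a b a' b', a ≠ b → a' ≠ b' → X a b = X a' b' → ∀ i, R i a b ↔ R i a' b') ∧
      (∀ a b s t, X b a s t ↔ X a b t s) ∧
      (IsTrichotomousClass K → ∀ i a b, a ≠ b → (R i a b ↔ ¬ R i b a)) ∧
      (IsSymmetricClass K → ∀ i a b, R i a b → R i b a) := by
  have := hK.isFraisse
  obtain ⟨Γ₀, _, _, hΓ₀, hs⟩ := hss
  have hC := isSelfSimilarClass hK hΓ₀ hs
  obtain ⟨Γ, _, _, f, hΓ, -, hf⟩ := h
  have hR := isGeneric_freePower hΓ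
  have hpair := hR.exists_pair hfr.exists_edge
  have : Nontrivial Γ := by
    obtain ⟨a, b, hab, -⟩ := hpair fun _ => True
    exact ⟨a, b, hab⟩
  have := hR.infinite hC
  obtain ⟨f', hf'⟩ := hR.exists_determined hM hC (f := f) fun i =>
    (hf 2 (powerRel m i)).imp fun φ hφ a b => hφ ![a, b]
  refine ⟨Γ, symRel (powerRel m), fun a b s t => Adjacent (f' a s) (f' b t), hpair,
    fun a b a' b' hab hab' hX => hf' a b a' b' hab hab' fun s t =>
      iff_of_eq (congrFun (congrFun hX s) t), fun a b s t => adjacent_comm hM _ _,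
    fun htri i a b hab => ?_, fun hsymm i a b hab => ?_⟩
  · exact EdgeClass.trichotomous htri
      (hR.age (V := ({a, b} : Set Γ)) Subtype.val_injective i)
      (x := ⟨a, by simp⟩) (y := ⟨b, by simp⟩) (fun h => hab (congrArg Subtype.val h))
  · exact EdgeClass.symmetric hsymm
      (hR.age (V := ({a, b} : Set Γ)) Subtype.val_injective i)
      (x := ⟨a, by simp⟩) (y := ⟨b, by simp⟩) hab

theorem kRankTuple_le {L₀ L : Language} [L₀.IsRelational]
    {K : Set (Bundled.{w} L₀.Structure)} {M : Type w'} [L.Structure M] {n N : ℕ}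
    (h : ∀ m, HasConfiguration (freePower K m) (eqSelf L M n) → m + 1 ≤ N) :
    kRankTuple L K M n ≤ (N : ℕ∞) :=
  iSup₂_le fun m hm => Nat.cast_le.2 (h m hm)

/-- A supremum of values below `N` need not be below `N` in general; here all of them are at most
the natural number `N - 1`. -/
theorem kRankTuple_lt {L₀ L : Language} [L₀.IsRelational]
    {K : Set (Bundled.{w} L₀.Structure)} {M : Type w'} [L.Structure M] {n N : ℕ} (hN : 0 < N)
    (h : ∀ m, HasConfiguration (freePower K m) (eqSelf L M n) → m + 1 < N) :
    kRankTuple L K M n < (N : ℕ∞) :=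
  (kRankTuple_le (N := N - 1) fun m hm => Nat.le_sub_one_of_lt (h m hm)).trans_lt
    (Nat.cast_lt.2 (Nat.sub_one_lt hN.ne'))

end Rank

end FirstOrder.Language

theorem mainTheorem12
    {M : Type w'} [FirstOrder.Language.graph.Structure M]
    (hT : M ⊨ FirstOrder.Language.randomGraphTheory)
    (hM : FirstOrder.Language.IsAlephOneSaturated FirstOrder.Language.graph M)
    (K : Set (CategoryTheory.Bundled.{w} FirstOrder.Language.edgeLanguage.Structure))
    (hK : FirstOrder.Language.IsAlgTrivialFraisse K)
    (hss : FirstOrder.Language.IsDefinablySelfSimilar K)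
    (hfr : FirstOrder.Language.IsFullyRelational K) :
    (∀ n : ℕ, 1 ≤ n →
      FirstOrder.Language.kRankTuple FirstOrder.Language.graph K M n ≤ ((n ^ 2 : ℕ) : ℕ∞)) ∧
    (FirstOrder.Language.IsReflexiveClass K ∨ FirstOrder.Language.IsIrreflexiveClass K →
      (FirstOrder.Language.IsTrichotomousClass K → ∀ n : ℕ, 1 ≤ n →
        FirstOrder.Language.kRankTuple FirstOrder.Language.graph K M n < ((n ^ 2 : ℕ) : ℕ∞)) ∧
      (FirstOrder.Language.IsSymmetricClass K → ∀ n : ℕ, 2 ≤ n →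
        FirstOrder.Language.kRankTuple FirstOrder.Language.graph K M n < ((n ^ 2 : ℕ) : ℕ∞))) := by
  have hconf := fun n m => FirstOrder.Language.HasConfiguration.exists_matrix (m := m) (n := n)
    hT hK hss hfr
  refine ⟨fun n _ => FirstOrder.Language.kRankTuple_le fun m hm => ?_, fun _ =>
    ⟨fun htri n hn => FirstOrder.Language.kRankTuple_lt (by positivity) fun m hm => ?_,
      fun hsymm n hn => FirstOrder.Language.kRankTuple_lt (by positivity) fun m hm => ?_⟩⟩
  · obtain ⟨Γ, R, X, hR, hX, -⟩ := hconf n m hm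
    exact (FirstOrder.Language.le_sq_of_determined hR hX).1
  · obtain ⟨Γ, R, X, hR, hX, htr, hasymm, -⟩ := hconf n m hm
    obtain ⟨hle, heq⟩ := FirstOrder.Language.le_sq_of_determined hR hX
    refine lt_of_le_of_ne hle fun hm => ?_
    -- The zero matrix is its own transpose, so `(a, b)` and `(b, a)` satisfy the same relations;
    -- relation `0` already contradicts trichotomy.
    obtain ⟨a, b, hab, hY⟩ := (heq hm).1 fun _ _ => False
    have h : X a b = X b a := by
      funext s t
      rw [htr a b s t, hY]
    have := (hX a b b a hab hab.symm h 0).symm.trans (hasymm htri 0 a b hab)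
    tauto
  · obtain ⟨Γ, R, X, hR, hX, htr, -, hs⟩ := hconf n m hm
    obtain ⟨hle, heq⟩ := FirstOrder.Language.le_sq_of_determined hR hX
    refine lt_of_le_of_ne hle fun hm => ?_
    let s₀ : Fin n := ⟨0, by lia⟩
    let s₁ : Fin n := ⟨1, by lia⟩
    -- A single off-diagonal entry makes the matrix non-symmetric; this needs two distinct indices,
    -- hence `n ≥ 2`.
    obtain ⟨a, b, hab, hY⟩ := (heq hm).1 fun s t => s = s₀ ∧ t = s₁
    have h := (heq hm).2 a b b a hab hab.symm fun i => ⟨hs hsymm i a b, hs hsymm i b a⟩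
    have h₀₁ := htr a b s₀ s₁
    rw [← h, hY] at h₀₁
    have : s₁ = s₀ := (h₀₁.1 ⟨rfl, rfl⟩).1
    simp [s₀, s₁] at this
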